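/- Let $n\ge 2$ and $l$ be integers with $4l>n+1$, let $Q=[0,2\pi]^n$, $K=[0,1]^n$, and for $t\in K$, $j\in\mathbb Z^n$ put $p_j(t)=t+j$, $p_j^{2l}(t)=|p_j(t)|^{2l}$ (Euclidean norm). For a $2\pi$-periodic function $f$ with Fourier coefficients $f_q=(2\pi)^{-n}\int_Q f(x)e^{-i\langle q,x\rangle}dx$ put $\|f\|_*=\sum_{q\in\mathbb Z^n}|f_q|$. Let $0<\beta<1$, $0<2\delta<(n-1)(1-\beta)$ be such that $$2\gamma_2:=4l-n-1-\beta(n-1)-2\delta>0,$$ and put $\gamma_0=2l-n-2\delta$. For $k>0$ let $C_0=\{z\in\mathbb C:|z-k^{2l}|=k^{2l-n-\delta}\}$. The non-resonant set $\chi_1(k,\beta,\delta)$ is the set of all $t\in K$ such that there is exactly one $j\in\mathbb Z^n$ with $p_j^{2l}(t)=k^{2l}$ and such that for every $z\in C_0$ $$|p_i^{2l}(t)-z|\ge k^{2l-n-\delta}\quad (i\in\mathbb Z^n),\qquad 200\,|p_i^{2l}(t)-z|\,|p_{i+q}^{2l}(t)-z|>k^{2\gamma_2}\quad (i,q\in\mathbb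 Z^n,\ 0<|q|<k^\beta).$$ Theorem. For every $M\ge 0$ there are $k_1>0$ and $C>0$, depending only on $n,l,\beta,\delta,M$, such that the following holds. Let $V(x)=\sum_{q\ne 0}v_qe^{i\langle q,x\rangle}$ be a real-valued trigonometric polynomial with zero mean and $\|V\|_*\le M$, let $k>k_1$ be such that every $q$ with $v_q\neq0$ satisfies $|q|<k^\beta$, and let $t\in K$ lie at distance less than $k^{-n+1-2\delta}$ from some point of $\chi_1(k,\beta,\delta)$. Then there is exactly one $j\in\mathbb Z^n$ with $|p_j^{2l}(t)-k^{2l}|<k^{2l-n-\delta}$. With this $j$, for all $\sigma\in\mathbb R$ and $A\in\mathbb C$ with $|\sigma||A|^2<k^{\gamma_0-\delta}$ there are a function $u\in C^{2l}(\mathbb R^n;\mathbb C)$ and a real number $\lambda$ such that $$(-\Delta)^l u(x)+V(x)u(x)+\sigma|u(x)|^2u(x)=\lambda u(x),\qquad x\in Q,$$ and $u$ satisfies the quasi-periodic boundary conditions: for $s=1,\dots,n$ and $m=0,\dots,2l-1$, the derivative $\partial^m u/\partial x_s^m$ at a point of the face $x_s=2\pi$ of $Q$ is $e^{2\pi i t_s}$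 times its value at the opposite point of the face $x_s=0$. Moreover $$u(x)=Ae^{i\langle p_j(t),x\rangle}\bigl(1+\tilde u(x)\bigr)\quad (x\in\mathbb R^n),$$ where $\tilde u$ is continuous, $2\pi$-periodic in each coordinate and $\|\tilde u\|_*\le k^{-\gamma_2}$, and $$\bigl|\lambda-p_j^{2l}(t)-\sigma|A|^2\bigr|\le C\,\bigl(k^{2l-n-\delta}+\sigma|A|^2\bigr)\,k^{-2\gamma_2}.$$ -/

import Mathlib

open scoped NNReal ENNReal

noncomputable section

namespace Polyharmonic

/-- The vector of `ℝⁿ` (with the Euclidean norm) with integer coordinates `q`. -/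
def latticeVec {n : ℕ} (q : Fin n → ℤ) : EuclideanSpace ℝ (Fin n) :=
  WithLp.toLp 2 (fun s => (q s : ℝ))

/-- The plane wave `x ↦ exp (i⟨p, x⟩)`. -/
def planeWave {n : ℕ} (p x : EuclideanSpace ℝ (Fin n)) : ℂ :=
  Complex.exp (Complex.I * ((inner ℝ p x : ℝ) : ℂ))

/-- The elementary cell `Q = [0, 2π]ⁿ`. -/
def cell (n : ℕ) : Set (EuclideanSpace ℝ (Fin n)) :=
  {x | ∀ s, x s ∈ Set.Icc 0 (2 * Real.pi)}

/-- The set of quasimomenta `K = [0, 1]ⁿ`. -/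
def momentumCell (n : ℕ) : Set (EuclideanSpace ℝ (Fin n)) :=
  {t | ∀ s, t s ∈ Set.Icc 0 1}

/-- `f` is `2π`-periodic in every coordinate. -/
def IsPeriodic {n : ℕ} (f : EuclideanSpace ℝ (Fin n) → ℂ) : Prop :=
  ∀ (q : Fin n → ℤ) (x : EuclideanSpace ℝ (Fin n)),
    f (x + (2 * Real.pi) • latticeVec q) = f x

/-- The Fourier coefficient `(2π)⁻ⁿ ∫_Q f(x) exp (-i⟨q, x⟩) dx`. -/
def fourierCoefficient {n : ℕ} (f : EuclideanSpace ℝ (Fin n) → ℂ) (q : Fin n → ℤ) : ℂ :=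
  (((2 * Real.pi) ^ n : ℝ) : ℂ)⁻¹ *
    ∫ x in cell n, f x * planeWave (-latticeVec q) x

/-- The norm `‖f‖_*`: the sum of the absolute values of all Fourier coefficients of a
(periodic) function, as an extended nonnegative number. -/
def starNorm {n : ℕ} (f : EuclideanSpace ℝ (Fin n) → ℂ) : ℝ≥0∞ :=
  ∑' q : Fin n → ℤ, ‖fourierCoefficient f q‖ₑ

/-- The trigonometric polynomial `∑ v_q exp (i⟨q, x⟩)` with finitely many coefficients `v`. -/
def trigPoly {n : ℕ} (v : (Fin n → ℤ) →₀ ℂ) (x : EuclideanSpace ℝ (Fin n)) : ℂ :=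
  ∑ q ∈ v.support, v q * planeWave (latticeVec q) x

/-- `p_j(t) = t + j`. -/
def momentum {n : ℕ} (t : EuclideanSpace ℝ (Fin n)) (j : Fin n → ℤ) :
    EuclideanSpace ℝ (Fin n) :=
  t + latticeVec j

/-- The eigenvalue `p_j^{2l}(t) = |p_j(t)|^{2l}` of the free operator. -/
def freeEigenvalue {n : ℕ} (l : ℕ) (t : EuclideanSpace ℝ (Fin n)) (j : Fin n → ℤ) : ℝ :=
  ‖momentum t j‖ ^ (2 * l)

/-- `γ₂`, given by `2γ₂ = 4l - n - 1 - β(n-1) - 2δ`. -/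
def gammaTwo (n l : ℕ) (β δ : ℝ) : ℝ :=
  (4 * (l : ℝ) - n - 1 - β * ((n : ℝ) - 1) - 2 * δ) / 2

/-- `γ₀ = 2l - n - 2δ`. -/
def gammaZero (n l : ℕ) (δ : ℝ) : ℝ :=
  2 * (l : ℝ) - n - 2 * δ

/-- The radius `k^{2l-n-δ}` of the circle `C₀` and of the interval around `k^{2l}`. -/
def contourRadius (n l : ℕ) (δ k : ℝ) : ℝ :=
  k ^ (2 * (l : ℝ) - n - δ)

/-- The circle `C₀ = {z : |z - k^{2l}| = k^{2l-n-δ}}`. -/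
def contour (n l : ℕ) (δ k : ℝ) : Set ℂ :=
  {z | ‖z - ((k ^ (2 * l) : ℝ) : ℂ)‖ = contourRadius n l δ k}

/-- The non-resonant set `χ₁(k, β, δ)`: the points `t` of the packed sphere `S₀(k)` lying on a
single sheet of it, at which no free eigenvalue is closer to `C₀` than `k^{2l-n-δ}` and the
products of small denominators are bounded from below. For the index with `|p_j(t)| = k` the
distance to `C₀` is exactly `k^{2l-n-δ}`, hence the non-strict inequality. -/
def nonResonantSet (n l : ℕ) (k β δ : ℝ) : Set (EuclideanSpace ℝ (Fin n)) :=
  {t | t ∈ momentumCell n ∧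
    (∃! j : Fin n → ℤ, freeEigenvalue l t j = k ^ (2 * l)) ∧
    ∀ z ∈ contour n l δ k,
      (∀ i : Fin n → ℤ, contourRadius n l δ k ≤ ‖(freeEigenvalue l t i : ℂ) - z‖) ∧
      (∀ i q : Fin n → ℤ, q ≠ 0 → ‖latticeVec q‖ < k ^ β →
        k ^ (2 * gammaTwo n l β δ) <
          200 * ‖(freeEigenvalue l t i : ℂ) - z‖ * ‖(freeEigenvalue l t (i + q) : ℂ) - z‖)}

/-- The `k^{-n+1-2δ}`-neighbourhood in `K` of the non-resonant set. -/
def nonResonantNhd (n l : ℕ) (k β δ : ℝ) : Set (EuclideanSpace ℝ (Fin n)) :=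
  {t | t ∈ momentumCell n ∧ ∃ t₀ ∈ nonResonantSet n l k β δ,
    dist t t₀ < k ^ (-(n : ℝ) + 1 - 2 * δ)}

/-- The polyharmonic operator `(-Δ)^l`. -/
def negLaplacianPow {n : ℕ} (l : ℕ) (u : EuclideanSpace ℝ (Fin n) → ℂ) :
    EuclideanSpace ℝ (Fin n) → ℂ :=
  (fun w : EuclideanSpace ℝ (Fin n) → ℂ => -(Laplacian.laplacian w))^[l] u

/-- The partial derivative `∂^m u / ∂x_s^m` at `x`. -/
def partialDeriv {n : ℕ} (s : Fin n) (m : ℕ) (u : EuclideanSpace ℝ (Fin n) → ℂ)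
    (x : EuclideanSpace ℝ (Fin n)) : ℂ :=
  iteratedFDeriv ℝ m u x (fun _ => EuclideanSpace.single s (1 : ℝ))

/-- The quasi-periodic boundary condition on `Q`: for every direction `s` and every order
`m = 0, …, 2l - 1`, the derivative `∂_s^m u` on the face `x_s = 2π` equals `exp (2πi t_s)` times
its value at the opposite point of the face `x_s = 0`. -/
def QuasiPeriodicBC {n : ℕ} (l : ℕ) (t : EuclideanSpace ℝ (Fin n))
    (u : EuclideanSpace ℝ (Fin n) → ℂ) : Prop :=
  ∀ (s : Fin n) (m : ℕ), m < 2 * l → ∀ x ∈ cell n, x s = 0 →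
    partialDeriv s m u (x + EuclideanSpace.single s (2 * Real.pi)) =
      Complex.exp (2 * Real.pi * Complex.I * (t s : ℂ)) * partialDeriv s m u x

/-- `u` is a classical solution of `(-Δ)^l u + V u + σ|u|²u = λ u` on `Q` with the
quasi-periodic boundary condition. -/
def IsQuasiPeriodicSolution {n : ℕ} (l : ℕ) (V : EuclideanSpace ℝ (Fin n) → ℂ) (σ : ℝ)
    (t : EuclideanSpace ℝ (Fin n)) (lam : ℝ) (u : EuclideanSpace ℝ (Fin n) → ℂ) : Prop :=
  ContDiff ℝ (2 * l : ℕ) u ∧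
  (∀ x ∈ cell n,
    negLaplacianPow l u x + V x * u x + (σ : ℂ) * ((‖u x‖ ^ 2 : ℝ) : ℂ) * u x
      = (lam : ℂ) * u x) ∧
  QuasiPeriodicBC l t u

end Polyharmonic

end

/-!
With `ρ = k^{2l-n-δ}` the radius of the contour, the solution is sought as
`u = A exp(i⟨p_j, x⟩) ∑ c_q exp(i⟨q, x⟩)` with `c = 1 + w`, `w_0 = 0`. Division by `ρ` turns the
equation into `a_q c_q + (b * c)_q + s (|c|²c)_q = ℓ c_q` in the convolution algebra `ℓ¹(ℤⁿ)`, where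
`a_q = (p_{j+q}^{2l} - p_j^{2l}) / ρ`, `b = v / ρ`, `s = σ|A|² / ρ` and `λ = p_j^{2l} + ρ ℓ`.

The potential need not be small compared with a single gap `a_q`, but non-resonance makes it small
compared with the geometric mean of the gaps at two indices that it couples. In the weighted
coordinates `y_q = m_q w_q`, with `m_q = √|a_q|` and `m_0 = 1`, convolution by `b` is therefore an
operator of norm `O(k^{-γ₂})` (`ScaledData.columnBounded`), and the cubic term carries the factor
`|s| ≤ k^{-2δ}`. The shift `ℓ` is the zeroth coordinate of the residual
`g = (b * c + s |c|²c) / m`, and the other coordinates of the equation read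
`y_q = -m_q² / (a_q - ℓ) g_q`, a map whose coefficients are bounded and Lipschitz in `ℓ` because
`|a_q| ≥ 1`. The composition is a contraction of the unit ball
(`ScaledData.exists_eq_correction`).

One more application of the equation to the fixed point gives `‖w‖ = O(ρ k^{-2γ₂} + k^{-2γ₂})`,
which beats `k^{-γ₂}` since `2δ < (n-1)(1-β)` forces `ρ ≤ k^{γ₂-δ}`; the shift satisfies
`ℓ - s = O(k^{-2γ₂})` because the zeroth coefficient of `|1 + w|²(1 + w)` has no linear term
(`norm_cubic_zero_sub_one_le`). The number `ℓ` is real because the equation has the form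
`a c + h * c = ℓ c` with `h` Hermitian (`ScaledData.exists_solution`).

The gap conditions pass from the non-resonant set to its neighbourhood in `eventually_gaps`, and
`isQuasiPeriodicSolution_of_coefficients` returns from coefficients to classical solutions: the
equation itself bounds `∑ p_{j+q}^{2l} |c_q|`, so the series may be differentiated `2l` times.
-/

open scoped NNReal ENNReal

noncomputable section

namespace Polyharmonic

/-! ### Operators on `ℓ¹` given by kernels -/

/-- The Banach space `ℓ¹(G)` of absolutely summable complex families. -/
abbrev EllOne (G : Type*) : Type _ := lp (fun _ : G => ℂ) 1

section Kernel

variable {G : Type*}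

/-- The columns of the kernel `κ` are summable, with `ℓ¹`-norm at most `B`. -/
def ColumnBounded (κ : G → G → ℂ) (B : ℝ) : Prop :=
  ∀ j, Summable (fun i => ‖κ i j‖) ∧ ∑' i, ‖κ i j‖ ≤ B

theorem EllOne.add_apply (f g : EllOne G) (i : G) : (f + g) i = f i + g i := rfl

theorem EllOne.sub_apply (f g : EllOne G) (i : G) : (f - g) i = f i - g i := rfl

theorem EllOne.smul_apply (a : ℂ) (f : EllOne G) (i : G) : (a • f) i = a * f i := rfl

theorem norm_apply_le_norm_lp_one (f : EllOne G) (i : G) : ‖f i‖ ≤ ‖f‖ :=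
  lp.norm_apply_le_norm (by simp) f i

theorem summable_norm_lp_one (f : EllOne G) : Summable (fun i => ‖f i‖) := by
  simpa using (lp.memℓp f).summable (by simp)

theorem norm_lp_one (f : EllOne G) : ‖f‖ = ∑' i, ‖f i‖ := by
  simpa using lp.norm_eq_tsum_rpow (p := 1) (by simp) f

/-- The element of `ℓ¹` with given summable coordinates. -/
def lpOneMk (f : G → ℂ) (hf : Summable fun i => ‖f i‖) : EllOne G :=
  ⟨f, memℓp_gen (by simpa using hf)⟩

@[simp]
theorem lpOneMk_apply (f : G → ℂ) (hf : Summable fun i => ‖f i‖) (i : G) :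
    lpOneMk f hf i = f i := rfl

theorem norm_lp_one_le_of_le {f : EllOne G} {g : G → ℝ} (hg : Summable g)
    (h : ∀ i, ‖f i‖ ≤ g i) : ‖f‖ ≤ ∑' i, g i := by
  rw [norm_lp_one]
  exact (summable_norm_lp_one f).tsum_le_tsum h hg

section

variable {κ : G → G → ℂ} {B : ℝ}

theorem ColumnBounded.summable_prod (h : ColumnBounded κ B) (f : EllOne G) :
    Summable (fun p : G × G => ‖κ p.1 p.2 * f p.2‖) := by
  have : Summable (fun p : G × G => ‖κ p.2 p.1 * f p.1‖) := by
    rw [summable_prod_of_nonneg (fun _ => norm_nonneg _)]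
    refine ⟨fun j => ?_, ?_⟩
    · simpa [norm_mul] using (h j).1.mul_right _
    · refine Summable.of_nonneg_of_le (fun j => tsum_nonneg fun _ => norm_nonneg _) (fun j => ?_)
        ((summable_norm_lp_one f).mul_left B)
      simp only [norm_mul, tsum_mul_right]
      exact mul_le_mul_of_nonneg_right (h j).2 (norm_nonneg _)
  exact (Equiv.prodComm G G).summable_iff.mp (by simpa [Function.comp_def] using this)

theorem ColumnBounded.summable_row (h : ColumnBounded κ B) (f : EllOne G) (i : G) :
    Summable (fun j => κ i j * f j) :=
  Summable.of_norm ((h.summable_prod f).prod_factor i)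

theorem ColumnBounded.summable_tsum (h : ColumnBounded κ B) (f : EllOne G) :
    Summable (fun i => ∑' j, ‖κ i j * f j‖) :=
  (h.summable_prod f).prod

theorem ColumnBounded.tsum_tsum_le (h : ColumnBounded κ B) (f : EllOne G) :
    ∑' i, ∑' j, ‖κ i j * f j‖ ≤ B * ‖f‖ := by
  have hs := h.summable_prod f
  have hcomm : ∑' i, ∑' j, ‖κ i j * f j‖ = ∑' j, ∑' i, ‖κ i j * f j‖ :=
    (Summable.tsum_comm (f := fun i j => ‖κ i j * f j‖) hs).symm
  rw [hcomm, norm_lp_one, ← tsum_mul_left]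
  refine Summable.tsum_le_tsum (fun j => ?_)
    (((Equiv.prodComm G G).summable_iff.mpr hs).prod) ((summable_norm_lp_one f).mul_left B)
  simp only [norm_mul, tsum_mul_right]
  exact mul_le_mul_of_nonneg_right (h j).2 (norm_nonneg _)

theorem ColumnBounded.norm_tsum_le (h : ColumnBounded κ B) (f : EllOne G) (i : G) :
    ‖∑' j, κ i j * f j‖ ≤ ∑' j, ‖κ i j * f j‖ :=
  _root_.norm_tsum_le_tsum_norm ((h.summable_prod f).prod_factor i)

theorem ColumnBounded.summable_norm (h : ColumnBounded κ B) (f : EllOne G) :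
    Summable (fun i => ‖∑' j, κ i j * f j‖) :=
  (h.summable_tsum f).of_nonneg_of_le (fun _ => norm_nonneg _) (h.norm_tsum_le f)

/-- The operator `f ↦ (i ↦ ∑ j, κ i j * f j)` on `ℓ¹`, as a linear map; its bound is
`norm_kernelOp_le`. -/
def kernelOp (h : ColumnBounded κ B) : EllOne G →ₗ[ℂ] EllOne G where
  toFun f := lpOneMk (fun i => ∑' j, κ i j * f j) (h.summable_norm f)
  map_add' f g := by
    ext i
    simp only [lpOneMk_apply, EllOne.add_apply, mul_add]
    exact (h.summable_row f i).tsum_add (h.summable_row g i)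
  map_smul' a f := by
    ext i
    simp only [lpOneMk_apply, EllOne.smul_apply, RingHom.id_apply,
      ← tsum_mul_left]
    exact tsum_congr fun j => by ring

theorem kernelOp_apply (h : ColumnBounded κ B) (f : EllOne G) (i : G) :
    kernelOp h f i = ∑' j, κ i j * f j := rfl

theorem norm_kernelOp_le (h : ColumnBounded κ B) (f : EllOne G) :
    ‖kernelOp h f‖ ≤ B * ‖f‖ :=
  (norm_lp_one_le_of_le (h.summable_tsum f) (h.norm_tsum_le f)).trans (h.tsum_tsum_le f)

end

theorem columnBounded_diagonal [DecidableEq G] {d : G → ℂ} {B : ℝ} (hd : ∀ i, ‖d i‖ ≤ B) :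
    ColumnBounded (fun i j => if i = j then d j else 0) B := by
  intro j
  have : (fun i => ‖if i = j then d j else 0‖) = fun i => if i = j then ‖d j‖ else 0 := by
    ext i; split_ifs <;> simp
  refine ⟨?_, ?_⟩
  · rw [this]; exact (hasSum_ite_eq j _).summable
  · simp only [this, tsum_ite_eq]; exact hd j

open Classical in
/-- Multiplication by a bounded sequence on `ℓ¹`. -/
def diagOp {d : G → ℂ} {B : ℝ} (hd : ∀ i, ‖d i‖ ≤ B) : EllOne G →ₗ[ℂ] EllOne G :=
  kernelOp (columnBounded_diagonal hd)

@[simp]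
theorem diagOp_apply {d : G → ℂ} {B : ℝ} (hd : ∀ i, ‖d i‖ ≤ B) (f : EllOne G) (i : G) :
    diagOp hd f i = d i * f i := by
  classical
  rw [diagOp, kernelOp_apply, tsum_eq_single i (fun j hj => by simp [hj.symm])]
  simp

theorem norm_diagOp_le {d : G → ℂ} {B : ℝ} (hd : ∀ i, ‖d i‖ ≤ B) (f : EllOne G) :
    ‖diagOp hd f‖ ≤ B * ‖f‖ := norm_kernelOp_le _ _

end Kernel

/-! ### The convolution algebra `ℓ¹(G)` -/

section Convolution

variable {G : Type*} [AddCommGroup G]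

theorem columnBounded_sub (f : EllOne G) : ColumnBounded (fun i j => f (i - j)) ‖f‖ := by
  intro j
  refine ⟨(Equiv.subRight j).summable_iff.mpr (summable_norm_lp_one f), ?_⟩
  rw [norm_lp_one]
  exact ((Equiv.subRight j).tsum_eq (fun i => ‖f i‖)).le

/-- The convolution product of `ℓ¹(G)`. -/
def conv (f g : EllOne G) : EllOne G := kernelOp (columnBounded_sub f) g

theorem conv_apply (f g : EllOne G) (i : G) : conv f g i = ∑' j, f (i - j) * g j := rfl

theorem norm_conv_le (f g : EllOne G) : ‖conv f g‖ ≤ ‖f‖ * ‖g‖ := norm_kernelOp_le _ _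

theorem conv_add (f g h : EllOne G) : conv f (g + h) = conv f g + conv f h := map_add _ _ _

theorem conv_sub (f g h : EllOne G) : conv f (g - h) = conv f g - conv f h := map_sub _ _ _

theorem add_conv (f g h : EllOne G) : conv (f + g) h = conv f h + conv g h := by
  ext i
  simp only [conv_apply, EllOne.add_apply, add_mul]
  exact ((columnBounded_sub f).summable_row h i).tsum_add ((columnBounded_sub g).summable_row h i)

theorem smul_conv (a : ℂ) (f g : EllOne G) : conv (a • f) g = a • conv f g := by
  ext i
  simp only [conv_apply, EllOne.smul_apply, ← tsum_mul_left]
  exact tsum_congr fun j => by ring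

theorem sub_conv (f g h : EllOne G) : conv (f - g) h = conv f h - conv g h := by
  rw [sub_eq_add_neg, add_conv, ← neg_one_smul ℂ g, smul_conv, neg_one_smul, sub_eq_add_neg]

/-- The involution `f ↦ (i ↦ conj (f (-i)))` of `ℓ¹(G)`. -/
def reflectConj (f : EllOne G) : EllOne G :=
  lpOneMk (fun i => (starRingEnd ℂ) (f (-i))) (by
    simpa [Function.comp_def] using (Equiv.neg G).summable_iff.mpr (summable_norm_lp_one f))

@[simp]
theorem reflectConj_apply (f : EllOne G) (i : G) :
    reflectConj f i = (starRingEnd ℂ) (f (-i)) := rfl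

theorem norm_reflectConj (f : EllOne G) : ‖reflectConj f‖ = ‖f‖ := by
  rw [norm_lp_one, norm_lp_one]
  simpa using (Equiv.neg G).tsum_eq (fun i => ‖f i‖)

theorem reflectConj_add (f g : EllOne G) :
    reflectConj (f + g) = reflectConj f + reflectConj g := by
  ext i
  simp only [reflectConj_apply, EllOne.add_apply, map_add]

theorem reflectConj_sub (f g : EllOne G) :
    reflectConj (f - g) = reflectConj f - reflectConj g := by
  ext i
  simp only [reflectConj_apply, EllOne.sub_apply, map_sub]

theorem reflectConj_smul (a : ℝ) (f : EllOne G) :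
    reflectConj ((a : ℂ) • f) = (a : ℂ) • reflectConj f := by
  ext i
  simp only [reflectConj_apply, EllOne.smul_apply, map_mul, Complex.conj_ofReal]

theorem reflectConj_conv_reflectConj (f : EllOne G) :
    reflectConj (conv f (reflectConj f)) = conv f (reflectConj f) := by
  ext i
  simp only [reflectConj_apply, conv_apply, Complex.conj_tsum, map_mul, Complex.conj_conj]
  rw [← (Equiv.subRight i).tsum_eq]
  refine tsum_congr fun j => ?_
  simp only [Equiv.subRight_apply]
  rw [mul_comm]
  rw [show -i - (j - i) = -j by abel, neg_sub]

open Classical in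
/-- The unit of the convolution algebra. -/
def convOne : EllOne G := lp.single 1 (0 : G) (1 : ℂ)

theorem convOne_zero : (convOne : EllOne G) 0 = 1 := by
  classical
  simp [convOne]

theorem convOne_of_ne {i : G} (hi : i ≠ 0) : (convOne : EllOne G) i = 0 := by
  classical
  simp [convOne, hi]

theorem norm_convOne : ‖(convOne : EllOne G)‖ = 1 := by
  classical
  rw [norm_lp_one, tsum_eq_single 0 (fun i hi => by simp [convOne_of_ne hi]), convOne_zero]
  simp

theorem conv_convOne (f : EllOne G) : conv f convOne = f := by
  ext i
  rw [conv_apply, tsum_eq_single 0 (fun j hj => by simp [convOne_of_ne hj]), convOne_zero]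
  simp

theorem convOne_conv (f : EllOne G) : conv convOne f = f := by
  ext i
  rw [conv_apply, tsum_eq_single i
    (fun j hj => by simp [convOne_of_ne (sub_ne_zero.mpr hj.symm)]), sub_self, convOne_zero]
  simp

theorem reflectConj_convOne : reflectConj (convOne : EllOne G) = convOne := by
  ext i
  by_cases hi : i = 0
  · simp [hi, convOne_zero]
  · simp [convOne_of_ne hi, convOne_of_ne (neg_ne_zero.mpr hi)]

/-- The cubic map `c ↦ (c * c^*) * c` of the convolution algebra, which represents `|f|²f` on the
level of Fourier coefficients. -/
def cubic (c : EllOne G) : EllOne G := conv (conv c (reflectConj c)) c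

theorem cubic_convOne : cubic (convOne : EllOne G) = convOne := by
  simp [cubic, reflectConj_convOne, conv_convOne]

theorem norm_cubic_sub_le {c c' : EllOne G} (hc : ‖c‖ ≤ 2) (hc' : ‖c'‖ ≤ 2) :
    ‖cubic c - cubic c'‖ ≤ 12 * ‖c - c'‖ := by
  have key : cubic c - cubic c' = conv (conv (c - c') (reflectConj c)) c
      + conv (conv c' (reflectConj (c - c'))) c + conv (conv c' (reflectConj c')) (c - c') := by
    simp only [cubic, reflectConj_sub, conv_sub, sub_conv]
    abel
  have tri : ∀ f g h : EllOne G, ‖conv (conv f (reflectConj g)) h‖ ≤ ‖f‖ * ‖g‖ * ‖h‖ := by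
    intro f g h
    refine (norm_conv_le _ _).trans ?_
    gcongr
    simpa [norm_reflectConj] using norm_conv_le f (reflectConj g)
  rw [key]
  have h1 : ‖c - c'‖ * ‖c‖ * ‖c‖ ≤ ‖c - c'‖ * 2 * 2 := by gcongr
  have h2 : ‖c'‖ * ‖c - c'‖ * ‖c‖ ≤ 2 * ‖c - c'‖ * 2 := by gcongr
  have h3 : ‖c'‖ * ‖c'‖ * ‖c - c'‖ ≤ 2 * 2 * ‖c - c'‖ := by gcongr
  calc _ ≤ _ := norm_add₃_le
    _ ≤ ‖c - c'‖ * 2 * 2 + 2 * ‖c - c'‖ * 2 + 2 * 2 * ‖c - c'‖ :=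
      add_le_add_three ((tri _ _ _).trans h1) ((tri _ _ _).trans h2) ((tri _ _ _).trans h3)
    _ = _ := by ring

/-- The zeroth coefficient of `|1 + w|²(1 + w)` has no term linear in `w` when `w 0 = 0`. -/
theorem norm_cubic_zero_sub_one_le {w : EllOne G} (hw : w 0 = 0) (hw1 : ‖w‖ ≤ 1) :
    ‖cubic (convOne + w) 0 - 1‖ ≤ 4 * ‖w‖ ^ 2 := by
  have key : cubic (convOne + w) 0 - 1 = conv w w 0 + conv (reflectConj w) w 0
      + conv w (reflectConj w) 0 + conv (conv w (reflectConj w)) w 0 := by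
    simp only [cubic, reflectConj_add, reflectConj_convOne, conv_add, add_conv, conv_convOne,
      convOne_conv, EllOne.add_apply, convOne_zero, hw, reflectConj_apply, neg_zero,
      map_zero]
    ring
  have h2 : ∀ f g : EllOne G, ‖conv f g 0‖ ≤ ‖f‖ * ‖g‖ := fun f g =>
    (norm_apply_le_norm_lp_one _ _).trans (norm_conv_le f g)
  have hr := norm_reflectConj w
  have e1 := h2 w w
  have e2 := h2 (reflectConj w) w
  have e3 := h2 w (reflectConj w)
  have e4 : ‖conv (conv w (reflectConj w)) w 0‖ ≤ ‖w‖ * ‖w‖ := by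
    refine (h2 _ _).trans ?_
    gcongr
    refine (norm_conv_le _ _).trans ?_
    rw [hr]
    nlinarith [norm_nonneg w]
  rw [hr] at e2 e3
  rw [key]
  calc _ ≤ ‖conv w w 0‖ + ‖conv (reflectConj w) w 0‖ + ‖conv w (reflectConj w) 0‖
        + ‖conv (conv w (reflectConj w)) w 0‖ :=
        (norm_add_le _ _).trans (add_le_add_left norm_add₃_le _)
    _ ≤ _ := by nlinarith

/-- The quadratic form of a Hermitian convolution operator is real. -/
theorem tsum_conj_mul_conv_im {h c : EllOne G} (hh : reflectConj h = h) :
    (∑' i, (starRingEnd ℂ) (c i) * conv h c i).im = 0 := by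
  have hs : Summable (fun p : G × G => (starRingEnd ℂ) (c p.1) * (h (p.1 - p.2) * c p.2)) := by
    refine Summable.of_norm (((columnBounded_sub h).summable_prod c).mul_left ‖c‖
      |>.of_nonneg_of_le (fun _ => norm_nonneg _) fun p => ?_)
    rw [norm_mul, RCLike.norm_conj]
    gcongr
    exact norm_apply_le_norm_lp_one _ _
  have hconj : ∀ i, (starRingEnd ℂ) (h i) = h (-i) := fun i => by
    conv_rhs => rw [← hh]
    simp
  have hsum : ∑' i, (starRingEnd ℂ) (c i) * conv h c i
      = ∑' i, ∑' j, (starRingEnd ℂ) (c i) * (h (i - j) * c j) :=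
    tsum_congr fun i => by rw [conv_apply, tsum_mul_left]
  rw [← Complex.conj_eq_iff_im, hsum, Complex.conj_tsum]
  have hcomm := Summable.tsum_comm (f := fun i j => (starRingEnd ℂ) (c i) * (h (i - j) * c j)) hs
  rw [← hcomm]
  refine tsum_congr fun i => ?_
  rw [Complex.conj_tsum]
  refine tsum_congr fun j => ?_
  rw [map_mul, map_mul, hconj, neg_sub, Complex.conj_conj]
  ring

end Convolution

/-! ### The fixed point in `ℓ¹` -/

section FixedPoint

variable {G : Type*} [AddCommGroup G]

/-- The data of the rescaled equation `a q * c q + (b * c) q + s * (|c|²c) q = ℓ * c q`: the gaps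
`a` of the free spectrum, the Fourier coefficients `b` of the potential, and weights `m`,
controlled by `a`. In the weighted coordinates `m q * c q` convolution by `b` has norm at most `ε`,
because its kernel is dominated by the convolution kernel of `e`. -/
structure ScaledData (a m : G → ℝ) (b : EllOne G) (e : G → ℝ) (ε : ℝ) : Prop where
  gap_zero : a 0 = 0
  weight_zero : m 0 = 1
  one_le_weight : ∀ q, 1 ≤ m q
  weight_sq_le : ∀ q, q ≠ 0 → m q ^ 2 ≤ |a q|
  summable : Summable e
  tsum_le : ∑' q, e q ≤ ε
  norm_le : ∀ q q', ‖b (q - q')‖ ≤ e (q - q') * (m q * m q')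

/-- The factor `-m² / (a - ℓ)` relating the residual of the equation to the correction, set to
zero at the index `0` and outside the range of `ℓ` in which it is controlled. -/
def resolventFactor (a m : G → ℝ) (ℓ : ℂ) (q : G) : ℂ :=
  open Classical in if q = 0 ∨ 1 / 4 < ‖ℓ‖ then 0 else -(m q : ℂ) ^ 2 / ((a q : ℂ) - ℓ)

namespace ScaledData

variable {a m : G → ℝ} {b : EllOne G} {e : G → ℝ} {ε : ℝ}

theorem weight_pos (h : ScaledData a m b e ε) (q : G) : 0 < m q :=
  one_pos.trans_le (h.one_le_weight q)

theorem norm_weight (h : ScaledData a m b e ε) (q : G) : ‖(m q : ℂ)‖ = m q := by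
  rw [Complex.norm_real, Real.norm_of_nonneg (h.weight_pos q).le]

theorem half_weight_sq_le (h : ScaledData a m b e ε) {q : G} (hq : q ≠ 0) {ℓ : ℂ}
    (hℓ : ‖ℓ‖ ≤ 1 / 4) : m q ^ 2 / 2 ≤ ‖(a q : ℂ) - ℓ‖ := by
  have h1 := norm_sub_norm_le (a q : ℂ) ℓ
  rw [Complex.norm_real, Real.norm_eq_abs] at h1
  have h2 := h.weight_sq_le q hq
  nlinarith [h.one_le_weight q]

theorem norm_inv_weight_le (h : ScaledData a m b e ε) (q : G) : ‖((m q : ℂ))⁻¹‖ ≤ 1 := by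
  rw [norm_inv, h.norm_weight]
  exact inv_le_one_of_one_le₀ (h.one_le_weight q)

theorem norm_resolventFactor_le (h : ScaledData a m b e ε) (ℓ : ℂ) (q : G) :
    ‖resolventFactor a m ℓ q‖ ≤ 2 := by
  unfold resolventFactor
  split_ifs with hq
  · simp
  · push Not at hq
    have h1 := h.half_weight_sq_le hq.1 hq.2
    have h2 := h.weight_pos q
    rw [norm_div, norm_neg, norm_pow, h.norm_weight, div_le_iff₀ (lt_of_lt_of_le (by positivity) h1)]
    linarith

theorem norm_resolventFactor_sub_le (h : ScaledData a m b e ε) {ℓ ℓ' : ℂ} (hℓ : ‖ℓ‖ ≤ 1 / 4)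
    (hℓ' : ‖ℓ'‖ ≤ 1 / 4) (q : G) :
    ‖resolventFactor a m ℓ q - resolventFactor a m ℓ' q‖ ≤ 4 * ‖ℓ - ℓ'‖ := by
  unfold resolventFactor
  by_cases hq : q = 0
  · simp [hq]
  rw [if_neg (by push Not; exact ⟨hq, hℓ⟩), if_neg (by push Not; exact ⟨hq, hℓ'⟩)]
  have h1 := h.half_weight_sq_le hq hℓ
  have h1' := h.half_weight_sq_le hq hℓ'
  have h2 := h.one_le_weight q
  have hp : 0 < m q ^ 2 / 2 := by positivity
  have n1 : (a q : ℂ) - ℓ ≠ 0 := norm_pos_iff.mp (hp.trans_le h1)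
  have n1' : (a q : ℂ) - ℓ' ≠ 0 := norm_pos_iff.mp (hp.trans_le h1')
  have key : -(m q : ℂ) ^ 2 / ((a q : ℂ) - ℓ) - -(m q : ℂ) ^ 2 / ((a q : ℂ) - ℓ')
      = -(m q : ℂ) ^ 2 * (ℓ - ℓ') / (((a q : ℂ) - ℓ) * ((a q : ℂ) - ℓ')) := by
    field_simp
    ring
  rw [key, norm_div, norm_mul, norm_mul, norm_neg, norm_pow, h.norm_weight,
    div_le_iff₀ (mul_pos (hp.trans_le h1) (hp.trans_le h1'))]
  have h3 : m q ^ 2 / 2 * (m q ^ 2 / 2) ≤ ‖(a q : ℂ) - ℓ‖ * ‖(a q : ℂ) - ℓ'‖ :=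
    mul_le_mul h1 h1' hp.le (norm_nonneg _)
  have h4 : m q ^ 2 ≤ 4 * (m q ^ 2 / 2 * (m q ^ 2 / 2)) := by
    nlinarith [one_le_pow₀ (n := 2) h2]
  calc m q ^ 2 * ‖ℓ - ℓ'‖ ≤ (4 * (‖(a q : ℂ) - ℓ‖ * ‖(a q : ℂ) - ℓ'‖)) * ‖ℓ - ℓ'‖ := by
        gcongr; linarith
    _ = _ := by ring

theorem columnBounded (h : ScaledData a m b e ε) :
    ColumnBounded (fun q q' => b (q - q') / ((m q : ℂ) * (m q' : ℂ))) ε := by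
  have hle : ∀ q q', ‖b (q - q') / ((m q : ℂ) * (m q' : ℂ))‖ ≤ e (q - q') := fun q q' => by
    have := h.norm_le q q'
    rw [norm_div, norm_mul, h.norm_weight, h.norm_weight,
      div_le_iff₀ (mul_pos (h.weight_pos q) (h.weight_pos q'))]
    exact this
  intro q'
  have hs : Summable fun q => e (q - q') := (Equiv.subRight q').summable_iff.mpr h.summable
  have hs' := hs.of_nonneg_of_le (fun _ => norm_nonneg _) fun q => hle q q'
  refine ⟨hs', (hs'.tsum_le_tsum (fun q => hle q q') hs).trans ?_⟩
  exact ((Equiv.subRight q').tsum_eq e).le.trans h.tsum_le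

/-- Division by the weights. -/
def unweight (h : ScaledData a m b e ε) : EllOne G →ₗ[ℂ] EllOne G := diagOp h.norm_inv_weight_le

theorem unweight_apply (h : ScaledData a m b e ε) (f : EllOne G) (q : G) :
    h.unweight f q = (m q : ℂ)⁻¹ * f q := diagOp_apply _ _ _

theorem norm_unweight_le (h : ScaledData a m b e ε) (f : EllOne G) : ‖h.unweight f‖ ≤ ‖f‖ :=
  (norm_diagOp_le h.norm_inv_weight_le f).trans_eq (one_mul _)

theorem unweight_convOne (h : ScaledData a m b e ε) : h.unweight convOne = convOne := by
  ext q
  rw [h.unweight_apply]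
  by_cases hq : q = 0
  · simp [hq, convOne_zero, h.weight_zero]
  · simp [convOne_of_ne hq]

/-- The weighted residual `(b * c + s |c|²c) / m` at `c = 1 + y / m`. -/
def residual (h : ScaledData a m b e ε) (s : ℝ) (y : EllOne G) : EllOne G :=
  kernelOp h.columnBounded (convOne + y)
    + (s : ℂ) • h.unweight (cubic (h.unweight (convOne + y)))

/-- Up to the weight, the residual is the convolution part of the equation at `c = 1 + y / m`. -/
theorem residual_apply (h : ScaledData a m b e ε) (s : ℝ) (y : EllOne G) (q : G) :
    (m q : ℂ) * h.residual s y q = conv b (convOne + h.unweight y) q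
      + s * cubic (convOne + h.unweight y) q := by
  have hc : h.unweight (convOne + y) = convOne + h.unweight y := by
    rw [map_add, h.unweight_convOne]
  have hm : ∀ q, (m q : ℂ) ≠ 0 := fun q => by exact_mod_cast (h.weight_pos q).ne'
  rw [residual, hc, EllOne.add_apply, EllOne.smul_apply,
    unweight_apply, kernelOp_apply, conv_apply, mul_add, ← tsum_mul_left, ← hc]
  congr 1
  · refine tsum_congr fun q' => ?_
    rw [h.unweight_apply]
    field_simp [hm q, hm q']
  · field_simp [hm q]

theorem norm_residual_sub_le (h : ScaledData a m b e ε) (s : ℝ) {y y' : EllOne G}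
    (hy : ‖y‖ ≤ 1) (hy' : ‖y'‖ ≤ 1) :
    ‖h.residual s y - h.residual s y'‖ ≤ (ε + 12 * |s|) * ‖y - y'‖ := by
  have key : h.residual s y - h.residual s y' = kernelOp h.columnBounded (y - y')
      + (s : ℂ) • h.unweight (cubic (h.unweight (convOne + y))
        - cubic (h.unweight (convOne + y'))) := by
    rw [residual, residual, map_sub h.unweight, map_sub (kernelOp _), map_add (kernelOp _),
      map_add (kernelOp _), smul_sub]
    abel
  have hb : ∀ y : EllOne G, ‖y‖ ≤ 1 → ‖h.unweight (convOne + y)‖ ≤ 2 := fun y hy => by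
    refine (h.norm_unweight_le _).trans ((norm_add_le _ _).trans ?_)
    rw [norm_convOne]
    linarith
  have h1 := norm_kernelOp_le h.columnBounded (y - y')
  have h2 := norm_cubic_sub_le (hb y hy) (hb y' hy')
  rw [← map_sub, add_sub_add_left_eq_sub] at h2
  have h3 := h2.trans (mul_le_mul_of_nonneg_left (h.norm_unweight_le (y - y')) (by norm_num))
  have h4 := (h.norm_unweight_le (cubic (h.unweight (convOne + y))
        - cubic (h.unweight (convOne + y')))).trans h3
  rw [key]
  refine (norm_add_le _ _).trans ?_
  rw [norm_smul, Complex.norm_real, Real.norm_eq_abs]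
  have h5 := mul_le_mul_of_nonneg_left h4 (abs_nonneg s)
  linarith

theorem residual_zero (h : ScaledData a m b e ε) (s : ℝ) :
    h.residual s 0 = kernelOp h.columnBounded convOne + (s : ℂ) • convOne := by
  rw [residual, add_zero, h.unweight_convOne, cubic_convOne, h.unweight_convOne]

theorem norm_residual_zero_le (h : ScaledData a m b e ε) (s : ℝ) :
    ‖h.residual s 0‖ ≤ ε + |s| := by
  rw [h.residual_zero]
  refine (norm_add_le _ _).trans ?_
  have := norm_kernelOp_le h.columnBounded convOne
  rw [norm_smul, norm_convOne, Complex.norm_real, Real.norm_eq_abs]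
  rw [norm_convOne] at this
  linarith

/-- The correction determined by a residual `g`, whose coordinate `g 0` is the shift of the
eigenvalue. -/
def correction (h : ScaledData a m b e ε) (g : EllOne G) : EllOne G :=
  diagOp (h.norm_resolventFactor_le (g 0)) g

theorem correction_apply (h : ScaledData a m b e ε) (g : EllOne G) (q : G) :
    h.correction g q = resolventFactor a m (g 0) q * g q := diagOp_apply _ _ _

theorem norm_correction_sub_le (h : ScaledData a m b e ε) {g g' : EllOne G}
    (hg : ‖g‖ ≤ 1 / 4) (hg' : ‖g'‖ ≤ 1 / 4) :
    ‖h.correction g - h.correction g'‖ ≤ 3 * ‖g - g'‖ := by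
  have hs := ((summable_norm_lp_one (g - g')).mul_left 2).add
    ((summable_norm_lp_one g').mul_left (4 * ‖g - g'‖))
  refine (norm_lp_one_le_of_le hs fun q => ?_).trans ?_
  · rw [EllOne.sub_apply, correction_apply, correction_apply]
    have e1 : resolventFactor a m (g 0) q * g q - resolventFactor a m (g' 0) q * g' q
        = resolventFactor a m (g 0) q * (g - g') q
          + (resolventFactor a m (g 0) q - resolventFactor a m (g' 0) q) * g' q := by
      rw [EllOne.sub_apply]; ring
    rw [e1]
    refine (norm_add_le _ _).trans ?_
    rw [norm_mul, norm_mul]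
    have e2 := h.norm_resolventFactor_sub_le ((norm_apply_le_norm_lp_one g 0).trans hg)
      ((norm_apply_le_norm_lp_one g' 0).trans hg') q
    have e3 : ‖g 0 - g' 0‖ ≤ ‖g - g'‖ := norm_apply_le_norm_lp_one (g - g') 0
    gcongr
    · exact h.norm_resolventFactor_le _ _
    · linarith
  · rw [Summable.tsum_add ((summable_norm_lp_one (g - g')).mul_left 2)
      ((summable_norm_lp_one g').mul_left (4 * ‖g - g'‖)), tsum_mul_left, tsum_mul_left,
      ← norm_lp_one, ← norm_lp_one]
    nlinarith [norm_nonneg (g - g')]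

theorem norm_correction_le (h : ScaledData a m b e ε) (g : EllOne G) :
    ‖h.correction g‖ ≤ 2 * ‖g‖ := norm_diagOp_le _ _

/-- The bounds `1 / 100` make `y ↦ correction (residual y)` a self-map of the unit ball with Lipschitz
constant `3 (ε + 12 |s|) ≤ 1 / 2`. -/
theorem exists_eq_correction (h : ScaledData a m b e ε) (hε : ε ≤ 1 / 100) {s : ℝ}
    (hs : |s| ≤ 1 / 100) :
    ∃ y : EllOne G, ‖y‖ ≤ 1 ∧ ‖h.residual s y‖ ≤ 1 / 4 ∧ y = h.correction (h.residual s y) := by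
  have hε0 : 0 ≤ ε := (norm_nonneg _).trans
    ((norm_kernelOp_le h.columnBounded convOne).trans_eq (by rw [norm_convOne, mul_one]))
  have hres : ∀ y : EllOne G, ‖y‖ ≤ 1 → ‖h.residual s y‖ ≤ 1 / 4 := fun y hy => by
    have h1 := h.norm_residual_sub_le s hy (y' := 0) (by simp)
    have h2 := h.norm_residual_zero_le s
    have h3 := norm_le_norm_add_norm_sub' (h.residual s y) (h.residual s 0)
    rw [sub_zero] at h1
    nlinarith [abs_nonneg s, norm_nonneg y]
  set T : EllOne G → EllOne G := fun y => h.correction (h.residual s y)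
  have hmaps : Set.MapsTo T (Metric.closedBall 0 1) (Metric.closedBall 0 1) := by
    intro y hy
    rw [mem_closedBall_zero_iff] at hy ⊢
    have := h.norm_correction_le (h.residual s y)
    linarith [hres y hy]
  have hcontr : ContractingWith (1 / 2) (hmaps.restrict T _ _) := by
    refine ⟨by rw [← NNReal.coe_lt_coe]; norm_num, LipschitzWith.of_dist_le_mul fun y y' => ?_⟩
    have hy := mem_closedBall_zero_iff.mp y.2
    have hy' := mem_closedBall_zero_iff.mp y'.2
    rw [Subtype.dist_eq, Subtype.dist_eq, dist_eq_norm, dist_eq_norm]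
    refine (h.norm_correction_sub_le (hres _ hy) (hres _ hy')).trans ?_
    have h1 := h.norm_residual_sub_le s hy hy'
    push_cast
    nlinarith [norm_nonneg ((y : EllOne G) - y')]
  obtain ⟨y, hy, hfix, -⟩ := hcontr.exists_fixedPoint' Metric.isClosed_closedBall.isComplete hmaps
    (Metric.mem_closedBall_self zero_le_one) (edist_ne_top _ _)
  rw [mem_closedBall_zero_iff] at hy
  exact ⟨y, hy, hres y hy, hfix.symm⟩

/-- The term `s • 1` of the residual, which is not small compared with `ε`, only shifts the
eigenvalue: the correction does not see the index `0`. -/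
theorem diagOp_resolventFactor_convOne (h : ScaledData a m b e ε) (s : ℝ) (g : EllOne G) :
    diagOp (h.norm_resolventFactor_le (g 0)) ((s : ℂ) • (convOne : EllOne G)) = 0 := by
  ext q
  rw [diagOp_apply, EllOne.smul_apply]
  by_cases hq : q = 0
  · simp [resolventFactor, hq]
  · simp [convOne_of_ne hq]

theorem norm_fixedPoint_le (h : ScaledData a m b e ε) (hε : ε ≤ 1 / 100) {s : ℝ}
    (hs : |s| ≤ 1 / 100) {y : EllOne G} (hy : ‖y‖ ≤ 1) (hres : ‖h.residual s y‖ ≤ 1 / 4)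
    (hfix : y = h.correction (h.residual s y)) : ‖y‖ ≤ 4 * ε := by
  have h0 : ‖h.residual s 0‖ ≤ 1 / 4 := (h.norm_residual_zero_le s).trans (by linarith)
  have h1 := h.norm_correction_sub_le hres h0
  rw [← hfix] at h1
  have h2 := h.norm_residual_sub_le s hy (y' := 0) (by simp)
  rw [sub_zero] at h2
  have h3 : ‖h.correction (h.residual s 0)‖ ≤ 2 * ε := by
    rw [correction]
    conv_lhs => enter [1, 2]; rw [h.residual_zero]
    rw [map_add, h.diagOp_resolventFactor_convOne, add_zero]
    refine (norm_diagOp_le _ _).trans ?_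
    have := norm_kernelOp_le h.columnBounded convOne
    rw [norm_convOne] at this
    linarith
  have h4 := norm_le_norm_add_norm_sub' y (h.correction (h.residual s 0))
  nlinarith [norm_nonneg y]

/-- The unweighted correction is smaller than the weighted one: the first-order term is divided by
`m²`, and all other terms are quadratic in `ε` or absorbed by the factor `|s|`. -/
theorem norm_unweight_fixedPoint_le (h : ScaledData a m b e ε) {s : ℝ}
    (hs : |s| ≤ 1 / 100) {y : EllOne G} (hy : ‖y‖ ≤ 1) (hyε : ‖y‖ ≤ 4 * ε)
    (hfix : y = h.correction (h.residual s y)) {ε₂ : ℝ}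
    (hε₂ : ∑' q, ‖b q‖ / m q ^ 2 ≤ ε₂) : ‖h.unweight y‖ ≤ 4 * ε₂ + 16 * ε ^ 2 := by
  set w := h.unweight y with hw
  set d := h.norm_resolventFactor_le (h.residual s y 0)
  have hε0 : 0 ≤ ε := by linarith [norm_nonneg y]
  have hc : h.unweight (convOne + y) = convOne + w := by
    rw [map_add, h.unweight_convOne]
  have hw1 : ‖w‖ ≤ 1 := (h.norm_unweight_le y).trans hy
  have hdec : h.residual s y = kernelOp h.columnBounded convOne + (s : ℂ) • convOne
      + (kernelOp h.columnBounded y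
        + (s : ℂ) • h.unweight (cubic (convOne + w) - cubic convOne)) := by
    rw [residual, hc, map_add (kernelOp _), map_sub, cubic_convOne, h.unweight_convOne, smul_sub]
    abel
  have hw' : w = h.unweight (diagOp d (kernelOp h.columnBounded convOne))
      + h.unweight (diagOp d (kernelOp h.columnBounded y
        + (s : ℂ) • h.unweight (cubic (convOne + w) - cubic convOne))) := by
    rw [← map_add]
    conv_lhs => rw [hw, hfix, correction]
    conv_lhs => enter [2, 2]; rw [hdec]
    rw [map_add (diagOp _), map_add (diagOp _),
      h.diagOp_resolventFactor_convOne, add_zero]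
  have h1 : ‖h.unweight (diagOp d (kernelOp h.columnBounded convOne))‖ ≤ 2 * ε₂ := by
    have hsum : Summable fun q => ‖b q‖ / m q ^ 2 :=
      (summable_norm_lp_one b).of_nonneg_of_le (fun q => by positivity) fun q =>
        div_le_self (norm_nonneg _) (one_le_pow₀ (h.one_le_weight q))
    refine (norm_lp_one_le_of_le (hsum.mul_left 2) fun q => ?_).trans
      ((tsum_mul_left).trans_le (mul_le_mul_of_nonneg_left hε₂ (by norm_num)))
    have hK : kernelOp h.columnBounded convOne q = b q / m q := by
      rw [kernelOp_apply, tsum_eq_single 0 (fun j hj => by simp [convOne_of_ne hj]), convOne_zero]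
      simp [h.weight_zero]
    rw [h.unweight_apply, diagOp_apply, hK, norm_mul, norm_mul, norm_div, norm_inv, h.norm_weight]
    have hm := h.weight_pos q
    calc (m q)⁻¹ * (‖resolventFactor a m (h.residual s y 0) q‖ * (‖b q‖ / m q))
        ≤ (m q)⁻¹ * (2 * (‖b q‖ / m q)) := by gcongr; exact h.norm_resolventFactor_le _ _
      _ = _ := by field_simp
  have h2 : ‖cubic (convOne + w) - cubic convOne‖ ≤ 12 * ‖w‖ := by
    refine (norm_cubic_sub_le ?_ (by rw [norm_convOne]; norm_num)).trans_eq ?_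
    · refine (norm_add_le _ _).trans ?_
      rw [norm_convOne]; linarith
    · rw [add_sub_cancel_left]
  have h3 : ‖kernelOp h.columnBounded y + (s : ℂ) • h.unweight (cubic (convOne + w)
      - cubic convOne)‖ ≤ ε * (4 * ε) + |s| * (12 * ‖w‖) := by
    refine (norm_add_le _ _).trans (add_le_add ((norm_kernelOp_le _ _).trans (by gcongr)) ?_)
    rw [norm_smul, Complex.norm_real, Real.norm_eq_abs]
    gcongr
    exact (h.norm_unweight_le _).trans h2
  have h4 := (h.norm_unweight_le _).trans ((norm_diagOp_le d _).trans
    (mul_le_mul_of_nonneg_left h3 (by norm_num)))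
  have h5 := norm_add_le (h.unweight (diagOp d (kernelOp h.columnBounded convOne)))
    (h.unweight (diagOp d (kernelOp h.columnBounded y
        + (s : ℂ) • h.unweight (cubic (convOne + w) - cubic convOne))))
  rw [← hw'] at h5
  nlinarith [norm_nonneg w]

/-- Solution of the rescaled equation, with the estimates of the correction and of the shift of
the eigenvalue. The shift is real because the equation is `h * c` with a Hermitian `h`. -/
theorem exists_solution (h : ScaledData a m b e ε) (hε : ε ≤ 1 / 100) {s : ℝ}
    (hs : |s| ≤ 1 / 100) (hb0 : b 0 = 0) (hb : reflectConj b = b) {ε₂ : ℝ}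
    (hε₂ : ∑' q, ‖b q‖ / m q ^ 2 ≤ ε₂) :
    ∃ (w : EllOne G) (ℓ : ℝ),
      (∀ q, (a q : ℂ) * (convOne + w : EllOne G) q + (conv b (convOne + w) q + s * cubic (convOne + w) q)
        = ℓ * (convOne + w : EllOne G) q) ∧
      ‖w‖ ≤ 4 * ε₂ + 16 * ε ^ 2 ∧ |ℓ - s| ≤ 4 * ε ^ 2 + 4 * ‖w‖ ^ 2 := by
  obtain ⟨y, hy, hres, hfix⟩ := h.exists_eq_correction hε hs
  have hyε := h.norm_fixedPoint_le hε hs hy hres hfix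
  have hwε := h.norm_unweight_fixedPoint_le hs hy hyε hfix hε₂
  set w := h.unweight y with hw
  set ℓ := h.residual s y 0 with hℓ
  have hε0 : 0 ≤ ε := by linarith [norm_nonneg y]
  have hℓ4 : ‖ℓ‖ ≤ 1 / 4 := (norm_apply_le_norm_lp_one _ _).trans hres
  have hw0 : w 0 = 0 := by
    rw [hw, h.unweight_apply, hfix, h.correction_apply]
    simp [resolventFactor]
  have hℓeq : ℓ = conv b (convOne + w) 0 + s * cubic (convOne + w) 0 := by
    rw [← h.residual_apply, h.weight_zero, Complex.ofReal_one, one_mul]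
  have heq : ∀ q, (a q : ℂ) * (convOne + w : EllOne G) q
      + (conv b (convOne + w) q + s * cubic (convOne + w) q) = ℓ * (convOne + w : EllOne G) q := by
    intro q
    by_cases hq : q = 0
    · rw [hq, ← hℓeq, EllOne.add_apply, hw0, convOne_zero, h.gap_zero]
      simp
    · have hm : (m q : ℂ) ≠ 0 := by exact_mod_cast (h.weight_pos q).ne'
      have hne : (a q : ℂ) - ℓ ≠ 0 := by
        have h1 := h.half_weight_sq_le hq hℓ4
        have h2 := h.weight_pos q
        exact norm_pos_iff.mp (lt_of_lt_of_le (by positivity) h1)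
      rw [← h.residual_apply, EllOne.add_apply, convOne_of_ne hq, zero_add, hw, h.unweight_apply]
      have hyq : y q = -(m q : ℂ) ^ 2 / ((a q : ℂ) - ℓ) * h.residual s y q := by
        conv_lhs => rw [hfix, h.correction_apply, resolventFactor]
        rw [if_neg (by push Not; exact ⟨hq, hℓ4⟩)]
      rw [hyq]
      field_simp
      ring
  have hshift : ‖ℓ - s‖ ≤ 4 * ε ^ 2 + 4 * ‖w‖ ^ 2 := by
    have hb1 : conv b (convOne + w) 0 = kernelOp h.columnBounded y 0 := by
      rw [conv_add, conv_convOne, EllOne.add_apply, hb0, zero_add, conv_apply, kernelOp_apply]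
      refine tsum_congr fun q => ?_
      rw [h.weight_zero, hw, h.unweight_apply]
      push_cast
      ring
    have e1 : ℓ - s = kernelOp h.columnBounded y 0 + s * (cubic (convOne + w) 0 - 1) := by
      rw [hℓeq, hb1]; ring
    have e2 := (norm_apply_le_norm_lp_one _ 0).trans (norm_kernelOp_le h.columnBounded y)
    have e3 := norm_cubic_zero_sub_one_le hw0 ((h.norm_unweight_le y).trans hy)
    rw [e1]
    refine (norm_add_le _ _).trans ?_
    rw [norm_mul, Complex.norm_real, Real.norm_eq_abs]
    have e4 : |s| * ‖cubic (convOne + w) 0 - 1‖ ≤ 1 * (4 * ‖w‖ ^ 2) :=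
      mul_le_mul (by linarith) e3 (norm_nonneg _) zero_le_one
    have e5 : ε * ‖y‖ ≤ ε * (4 * ε) := by gcongr
    nlinarith
  have hreal : ℓ.im = 0 := by
    -- Pairing the equation with `c` gives `Im ⟨c, g * c⟩ = Im ℓ ‖c‖²`, and the left side vanishes.
    set c := convOne + w with hc
    set g := b + (s : ℂ) • conv c (reflectConj c) with hg
    have hgg : reflectConj g = g := by
      rw [hg, reflectConj_add, reflectConj_smul, hb, reflectConj_conv_reflectConj]
    have hF : ∀ q, conv b c q + s * cubic c q = conv g c q := fun q => by
      rw [hg, add_conv, smul_conv, EllOne.add_apply, EllOne.smul_apply, cubic]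
    have him : ∀ q, ((starRingEnd ℂ) (c q) * conv g c q).im = ℓ.im * Complex.normSq (c q) := by
      intro q
      have e1 : (starRingEnd ℂ) (c q) * conv g c q = (ℓ - a q) * (Complex.normSq (c q) : ℂ) := by
        rw [Complex.normSq_eq_conj_mul_self, ← hF, ← sub_eq_iff_eq_add'.mpr (heq q).symm]
        ring
      rw [e1, Complex.im_mul_ofReal]
      simp
    have hsum : Summable fun q => (starRingEnd ℂ) (c q) * conv g c q := by
      refine Summable.of_norm (((summable_norm_lp_one (conv g c)).mul_left ‖c‖).of_nonneg_of_le
        (fun _ => norm_nonneg _) fun q => ?_)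
      rw [norm_mul, RCLike.norm_conj]
      gcongr
      exact norm_apply_le_norm_lp_one _ _
    have hsq : Summable fun q => Complex.normSq (c q) := by
      refine ((summable_norm_lp_one c).mul_left ‖c‖).of_nonneg_of_le
        (fun _ => Complex.normSq_nonneg _) fun q => ?_
      rw [Complex.normSq_eq_norm_sq, sq]
      gcongr
      exact norm_apply_le_norm_lp_one _ _
    have h0 := tsum_conj_mul_conv_im (c := c) hgg
    rw [Complex.im_tsum hsum] at h0
    simp only [him, tsum_mul_left] at h0
    have hpos : 0 < ∑' q, Complex.normSq (c q) := by
      refine hsq.tsum_pos (fun _ => Complex.normSq_nonneg _) 0 ?_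
      rw [hc, EllOne.add_apply, convOne_zero, hw0]
      simp
    exact (mul_eq_zero.mp h0).resolve_right hpos.ne'
  have hre : ((ℓ.re : ℝ) : ℂ) = ℓ := Complex.ext (by simp) (by simp [hreal])
  refine ⟨w, ℓ.re, ?_, hwε, ?_⟩
  · rw [hre]; exact heq
  · rw [← hre, ← Complex.ofReal_sub, Complex.norm_real] at hshift
    exact hshift

end ScaledData

end FixedPoint

/-! ### Characters of the convolution algebra -/

section Character

theorem summable_mul_character {G : Type*} {χ : G → ℂ} (hχ : ∀ q, ‖χ q‖ = 1) (f : EllOne G) :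
    Summable fun q => f q * χ q :=
  Summable.of_norm (by simpa [hχ] using summable_norm_lp_one f)

variable {G : Type*} [AddCommGroup G] {χ : G → ℂ}

theorem tsum_conv_mul_character (hχ : ∀ q, ‖χ q‖ = 1) (hadd : ∀ q q', χ (q + q') = χ q * χ q')
    (f g : EllOne G) :
    ∑' q, conv f g q * χ q = (∑' q, f q * χ q) * ∑' q, g q * χ q := by
  have hf : Summable fun q => ‖f q * χ q‖ := by simpa [hχ] using summable_norm_lp_one f
  have hg : Summable fun q => ‖g q * χ q‖ := by simpa [hχ] using summable_norm_lp_one g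
  have hfg := summable_mul_of_summable_norm hf hg
  rw [tsum_mul_tsum_of_summable_norm hf hg]
  -- The sum over pairs of indices is rearranged along `(q, q') ↦ (q - q', q')`.
  let shear : G × G ≃ G × G :=
    { toFun := fun p => (p.1 - p.2, p.2)
      invFun := fun p => (p.1 + p.2, p.2)
      left_inv := fun p => by simp
      right_inv := fun p => by simp }
  have hterm : ∀ p : G × G, f (shear p).1 * χ (shear p).1 * (g (shear p).2 * χ (shear p).2)
      = f (p.1 - p.2) * g p.2 * χ p.1 := fun p => by
    have : χ p.1 = χ (p.1 - p.2) * χ p.2 := by rw [← hadd, sub_add_cancel]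
    rw [this]
    change f (p.1 - p.2) * χ (p.1 - p.2) * (g p.2 * χ p.2) = _
    ring
  rw [← shear.tsum_eq]
  have hs := shear.summable_iff.mpr hfg
  simp only [Function.comp_def, hterm] at hs
  simp only [hterm]
  rw [hs.tsum_prod]
  exact tsum_congr fun q => by rw [conv_apply, ← tsum_mul_right]

theorem tsum_reflectConj_mul_character (hinv : ∀ q, χ (-q) = (starRingEnd ℂ) (χ q))
    (f : EllOne G) :
    ∑' q, reflectConj f q * χ q = (starRingEnd ℂ) (∑' q, f q * χ q) := by
  rw [Complex.conj_tsum, ← (Equiv.neg G).tsum_eq]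
  exact tsum_congr fun q => by simp [hinv]

theorem tsum_convOne_mul_character (h0 : χ 0 = 1) :
    ∑' q, (convOne : EllOne G) q * χ q = 1 := by
  rw [tsum_eq_single 0 (fun q hq => by simp [convOne_of_ne hq]), convOne_zero, h0, one_mul]

theorem tsum_cubic_mul_character (hχ : ∀ q, ‖χ q‖ = 1) (hadd : ∀ q q', χ (q + q') = χ q * χ q')
    (hinv : ∀ q, χ (-q) = (starRingEnd ℂ) (χ q)) (f : EllOne G) :
    ∑' q, cubic f q * χ q = ((‖∑' q, f q * χ q‖ ^ 2 : ℝ) : ℂ) * ∑' q, f q * χ q := by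
  rw [cubic, tsum_conv_mul_character hχ hadd, tsum_conv_mul_character hχ hadd,
    tsum_reflectConj_mul_character hinv, Complex.mul_conj, Complex.normSq_eq_norm_sq]

end Character

/-! ### Superpositions of plane waves -/

section PlaneWave

variable {n : ℕ}

theorem norm_planeWave (p x : EuclideanSpace ℝ (Fin n)) : ‖planeWave p x‖ = 1 := by
  rw [planeWave, mul_comm, Complex.norm_exp_ofReal_mul_I]

theorem planeWave_add (p q x : EuclideanSpace ℝ (Fin n)) :
    planeWave (p + q) x = planeWave p x * planeWave q x := by
  rw [planeWave, planeWave, planeWave, ← Complex.exp_add, inner_add_left]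
  push_cast
  ring_nf

theorem planeWave_zero (x : EuclideanSpace ℝ (Fin n)) : planeWave 0 x = 1 := by
  simp [planeWave]

theorem planeWave_neg (p x : EuclideanSpace ℝ (Fin n)) :
    planeWave (-p) x = (starRingEnd ℂ) (planeWave p x) := by
  rw [planeWave, planeWave, ← Complex.exp_conj]
  simp

theorem planeWave_add_right (p x y : EuclideanSpace ℝ (Fin n)) :
    planeWave p (x + y) = planeWave p x * planeWave p y := by
  rw [planeWave, planeWave, planeWave, ← Complex.exp_add, inner_add_right]
  push_cast
  ring_nf

theorem latticeVec_add (q q' : Fin n → ℤ) :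
    latticeVec (q + q') = latticeVec q + latticeVec q' := by
  ext s; simp [latticeVec]

theorem latticeVec_neg (q : Fin n → ℤ) : latticeVec (-q) = -latticeVec q := by
  ext s; simp [latticeVec]

theorem latticeVec_zero : latticeVec (0 : Fin n → ℤ) = 0 := by
  ext s; simp [latticeVec]

theorem contDiff_planeWave (p : EuclideanSpace ℝ (Fin n)) {N : WithTop ℕ∞} :
    ContDiff ℝ N (planeWave p) := by
  unfold planeWave
  exact (contDiff_const.mul (Complex.ofRealCLM.contDiff.comp
    (contDiff_const.inner ℝ contDiff_id))).cexp

theorem iteratedDeriv_exp_I_mul (m : ℕ) :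
    iteratedDeriv m (fun s : ℝ => Complex.exp (Complex.I * s))
      = fun s : ℝ => Complex.I ^ m * Complex.exp (Complex.I * s) := by
  induction m with
  | zero => simp
  | succ m ih =>
    rw [iteratedDeriv_succ, ih]
    ext s
    have h : HasDerivAt (fun s : ℝ => Complex.I ^ m * Complex.exp (Complex.I * s))
        (Complex.I ^ m * (Complex.exp (Complex.I * s) * (Complex.I * 1))) s :=
      (((Complex.ofRealCLM.hasDerivAt (x := s)).const_mul Complex.I).cexp).const_mul _
    rw [h.deriv]
    ring

theorem iteratedFDeriv_planeWave (p x : EuclideanSpace ℝ (Fin n)) (m : ℕ) :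
    iteratedFDeriv ℝ m (planeWave p) x
      = (iteratedFDeriv ℝ m (fun s : ℝ => Complex.exp (Complex.I * s))
          (innerSL ℝ p x)).compContinuousLinearMap fun _ => innerSL ℝ p := by
  have hc : ContDiff ℝ m (fun s : ℝ => Complex.exp (Complex.I * s)) :=
    (contDiff_const.mul Complex.ofRealCLM.contDiff).cexp
  exact (innerSL ℝ p).iteratedFDeriv_comp_right hc x le_rfl

theorem iteratedFDeriv_planeWave_apply (p x : EuclideanSpace ℝ (Fin n)) (m : ℕ)
    (v : Fin m → EuclideanSpace ℝ (Fin n)) :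
    iteratedFDeriv ℝ m (planeWave p) x v
      = ((∏ i, inner ℝ p (v i) : ℝ) : ℂ) * Complex.I ^ m * planeWave p x := by
  rw [iteratedFDeriv_planeWave, ContinuousMultilinearMap.compContinuousLinearMap_apply,
    iteratedFDeriv_apply_eq_iteratedDeriv_mul_prod, iteratedDeriv_exp_I_mul, Complex.real_smul,
    mul_assoc]
  rfl

theorem norm_iteratedFDeriv_planeWave_le (p x : EuclideanSpace ℝ (Fin n)) (m : ℕ) :
    ‖iteratedFDeriv ℝ m (planeWave p) x‖ ≤ ‖p‖ ^ m := by
  rw [iteratedFDeriv_planeWave]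
  refine (ContinuousMultilinearMap.norm_compContinuousLinearMap_le _ _).trans_eq ?_
  rw [norm_iteratedFDeriv_eq_norm_iteratedDeriv, iteratedDeriv_exp_I_mul]
  simp [mul_comm Complex.I, Complex.norm_exp_ofReal_mul_I]

theorem iteratedFDeriv_const_mul_planeWave (a : ℂ) (p x : EuclideanSpace ℝ (Fin n)) (m : ℕ) :
    iteratedFDeriv ℝ m (fun x => a * planeWave p x) x = a • iteratedFDeriv ℝ m (planeWave p) x :=
  iteratedFDeriv_const_smul_apply (a := a) (contDiff_planeWave p).contDiffAt

section Superposition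

variable {ι : Type*} {c : ι → ℂ} {p : ι → EuclideanSpace ℝ (Fin n)} {N : ℕ}

theorem norm_iteratedFDeriv_const_mul_planeWave_le (i : ι) {m : ℕ} (hm : m ≤ N)
    (x : EuclideanSpace ℝ (Fin n)) :
    ‖iteratedFDeriv ℝ m (fun x => c i * planeWave (p i) x) x‖ ≤ ‖c i‖ * (1 + ‖p i‖) ^ N := by
  rw [iteratedFDeriv_const_mul_planeWave, norm_smul]
  gcongr
  calc _ ≤ ‖p i‖ ^ m := norm_iteratedFDeriv_planeWave_le _ _ _
    _ ≤ (1 + ‖p i‖) ^ m := by gcongr; linarith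
    _ ≤ (1 + ‖p i‖) ^ N := pow_le_pow_right₀ (by linarith [norm_nonneg (p i)]) hm

theorem contDiff_tsum_planeWave (h : Summable fun i => ‖c i‖ * (1 + ‖p i‖) ^ N) :
    ContDiff ℝ N fun x => ∑' i, c i * planeWave (p i) x := by
  refine contDiff_tsum (N := (N : ℕ∞)) (v := fun _ i => ‖c i‖ * (1 + ‖p i‖) ^ N)
    (fun i => contDiff_const.mul (contDiff_planeWave _)) (fun _ _ => h) fun m i x hm => ?_
  exact norm_iteratedFDeriv_const_mul_planeWave_le i (by exact_mod_cast hm) x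

theorem iteratedFDeriv_tsum_planeWave (h : Summable fun i => ‖c i‖ * (1 + ‖p i‖) ^ N) {m : ℕ}
    (hm : m ≤ N) (x : EuclideanSpace ℝ (Fin n)) (v : Fin m → EuclideanSpace ℝ (Fin n)) :
    iteratedFDeriv ℝ m (fun x => ∑' i, c i * planeWave (p i) x) x v
      = ∑' i, c i * (((∏ j, inner ℝ (p i) (v j) : ℝ) : ℂ) * Complex.I ^ m * planeWave (p i) x) := by
  have hbd : ∀ (k : ℕ) (i : ι) (x : EuclideanSpace ℝ (Fin n)), (k : ℕ∞) ≤ (N : ℕ∞) →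
      ‖iteratedFDeriv ℝ k (fun x => c i * planeWave (p i) x) x‖ ≤ ‖c i‖ * (1 + ‖p i‖) ^ N :=
    fun k i x hk => norm_iteratedFDeriv_const_mul_planeWave_le i (by exact_mod_cast hk) x
  rw [iteratedFDeriv_tsum_apply (N := (N : ℕ∞)) (v := fun _ i => ‖c i‖ * (1 + ‖p i‖) ^ N)
    (fun i => contDiff_const.mul (contDiff_planeWave _)) (fun _ _ => h) hbd
    (by exact_mod_cast hm)]
  have hs : Summable fun i => iteratedFDeriv ℝ m (fun x => c i * planeWave (p i) x) x :=
    Summable.of_norm_bounded h fun i => hbd m i x (by exact_mod_cast hm)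
  rw [ContinuousMultilinearMap.tsum_eval hs]
  refine tsum_congr fun i => ?_
  rw [iteratedFDeriv_const_mul_planeWave, smul_apply, iteratedFDeriv_planeWave_apply, smul_eq_mul]

theorem neg_laplacian_tsum_planeWave (h : Summable fun i => ‖c i‖ * (1 + ‖p i‖) ^ 2) :
    (-Laplacian.laplacian fun x => ∑' i, c i * planeWave (p i) x)
      = fun x => ∑' i, c i * ((‖p i‖ ^ 2 : ℝ) : ℂ) * planeWave (p i) x := by
  ext x
  have hs : ∀ s, Summable fun i => c i * (((∏ j, inner ℝ (p i)
      ((![EuclideanSpace.basisFun (Fin n) ℝ s, EuclideanSpace.basisFun (Fin n) ℝ s] :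
        Fin 2 → EuclideanSpace ℝ (Fin n)) j) : ℝ) : ℂ) * Complex.I ^ 2 * planeWave (p i) x) := by
    intro s
    refine Summable.of_norm_bounded h fun i => ?_
    rw [norm_mul, norm_mul, norm_mul, norm_planeWave, Complex.norm_real]
    have h1 : ‖inner ℝ (p i) (EuclideanSpace.basisFun (Fin n) ℝ s)‖ ≤ 1 + ‖p i‖ := by
      refine (norm_inner_le_norm _ _).trans ?_
      rw [OrthonormalBasis.norm_eq_one]; linarith
    simp only [Fin.prod_univ_two, Matrix.cons_val_zero, Matrix.cons_val_one, norm_mul, norm_pow,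
      Complex.norm_I, one_pow, mul_one]
    rw [sq (1 + ‖p i‖)]
    gcongr
  rw [Pi.neg_apply, InnerProductSpace.laplacian_eq_iteratedFDeriv_orthonormalBasis _
    (EuclideanSpace.basisFun (Fin n) ℝ)]
  simp only [iteratedFDeriv_tsum_planeWave h le_rfl]
  rw [← Summable.tsum_finsetSum fun s _ => hs s, ← tsum_neg]
  refine tsum_congr fun i => ?_
  rw [← Finset.mul_sum, ← Finset.sum_mul, ← Finset.sum_mul, ← Complex.ofReal_sum]
  simp only [Fin.prod_univ_two, Matrix.cons_val_zero, Matrix.cons_val_one]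
  have hn : ∑ s, inner ℝ (p i) (EuclideanSpace.basisFun (Fin n) ℝ s)
      * inner ℝ (p i) (EuclideanSpace.basisFun (Fin n) ℝ s) = ‖p i‖ ^ 2 := by
    rw [← (EuclideanSpace.basisFun (Fin n) ℝ).sum_sq_norm_inner_left]
    exact Finset.sum_congr rfl fun s _ => by rw [Real.norm_eq_abs, sq_abs, sq]
  rw [hn, Complex.I_sq]
  ring

theorem negLaplacianPow_tsum_planeWave (l : ℕ) (c : ι → ℂ)
    (h : Summable fun i => ‖c i‖ * (1 + ‖p i‖) ^ (2 * l)) :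
    (negLaplacianPow l fun x => ∑' i, c i * planeWave (p i) x)
      = fun x => ∑' i, c i * ((‖p i‖ ^ (2 * l) : ℝ) : ℂ) * planeWave (p i) x := by
  induction l generalizing c with
  | zero => simp [negLaplacianPow]
  | succ l ih =>
    have h2 : Summable fun i => ‖c i‖ * (1 + ‖p i‖) ^ 2 :=
      h.of_nonneg_of_le (fun i => by positivity) fun i => by
        gcongr
        · linarith [norm_nonneg (p i)]
        · omega
    have h2l : Summable fun i => ‖c i * ((‖p i‖ ^ 2 : ℝ) : ℂ)‖ * (1 + ‖p i‖) ^ (2 * l) :=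
      h.of_nonneg_of_le (fun i => by positivity) fun i => by
        rw [norm_mul, Complex.norm_real, norm_pow, norm_norm, mul_assoc, Nat.mul_succ,
          add_comm (2 * l), pow_add]
        gcongr
        linarith
    have := ih (fun i => c i * ((‖p i‖ ^ 2 : ℝ) : ℂ)) h2l
    rw [negLaplacianPow, Function.iterate_succ_apply, neg_laplacian_tsum_planeWave h2,
      ← negLaplacianPow, this]
    ext x
    refine tsum_congr fun i => ?_
    push_cast
    ring

end Superposition

theorem inner_single_two_pi (p : EuclideanSpace ℝ (Fin n)) (s : Fin n) :
    inner ℝ p (EuclideanSpace.single s (2 * Real.pi)) = 2 * Real.pi * p s := by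
  simp [EuclideanSpace.inner_single_right]

theorem planeWave_momentum_single (t : EuclideanSpace ℝ (Fin n)) (j : Fin n → ℤ) (s : Fin n) :
    planeWave (momentum t j) (EuclideanSpace.single s (2 * Real.pi))
      = Complex.exp (2 * Real.pi * Complex.I * (t s : ℂ)) := by
  have h : (momentum t j) s = t s + j s := by simp [momentum, latticeVec]
  rw [planeWave, inner_single_two_pi, h]
  have : Complex.I * ((2 * Real.pi * (t s + j s) : ℝ) : ℂ)
      = 2 * Real.pi * Complex.I * (t s : ℂ) + (j s : ℂ) * (2 * Real.pi * Complex.I) := by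
    push_cast; ring
  rw [this, Complex.exp_add, Complex.exp_int_mul_two_pi_mul_I, mul_one]

theorem quasiPeriodicBC_tsum_planeWave {ι : Type*} {l : ℕ} {t : EuclideanSpace ℝ (Fin n)}
    {c : ι → ℂ} {J : ι → Fin n → ℤ}
    (h : Summable fun i => ‖c i‖ * (1 + ‖momentum t (J i)‖) ^ (2 * l)) :
    QuasiPeriodicBC l t fun x => ∑' i, c i * planeWave (momentum t (J i)) x := by
  intro s m hm x _ _
  rw [partialDeriv, partialDeriv, iteratedFDeriv_tsum_planeWave h hm.le,
    iteratedFDeriv_tsum_planeWave h hm.le, ← tsum_mul_left]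
  refine tsum_congr fun i => ?_
  rw [planeWave_add_right, planeWave_momentum_single]
  ring

end PlaneWave

/-! ### Fourier coefficients of absolutely convergent series -/

section Fourier

variable {n : ℕ}

theorem integral_exp_int_mul (m : ℤ) :
    ∫ x in Set.Icc 0 (2 * Real.pi), Complex.exp (Complex.I * ((m * x : ℝ) : ℂ))
      = if m = 0 then ((2 * Real.pi : ℝ) : ℂ) else 0 := by
  rw [MeasureTheory.integral_Icc_eq_integral_Ioc,
    ← intervalIntegral.integral_of_le Real.two_pi_pos.le]
  split_ifs with hm
  · simp [hm]
  · have hc : (Complex.I * m : ℂ) ≠ 0 := mul_ne_zero Complex.I_ne_zero (by exact_mod_cast hm)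
    have : ∀ x : ℝ, Complex.exp (Complex.I * ((m * x : ℝ) : ℂ))
        = Complex.exp ((Complex.I * m) * x) := fun x => by push_cast; ring_nf
    simp only [this]
    rw [integral_exp_mul_complex hc]
    have h1 : Complex.I * m * ((2 * Real.pi : ℝ) : ℂ) = m * (2 * Real.pi * Complex.I) := by
      push_cast; ring
    rw [h1, Complex.exp_int_mul_two_pi_mul_I]
    simp

theorem cell_eq_preimage :
    cell n = WithLp.ofLp ⁻¹' (Set.univ.pi fun _ : Fin n => Set.Icc 0 (2 * Real.pi)) := by
  ext x
  exact ⟨fun h s _ => h s, fun h s => h s trivial⟩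

theorem setIntegral_cell (f : (Fin n → ℝ) → ℂ) :
    ∫ x in cell n, f (WithLp.ofLp x)
      = ∫ y in Set.univ.pi fun _ : Fin n => Set.Icc 0 (2 * Real.pi), f y := by
  rw [cell_eq_preimage]
  exact (PiLp.volume_preserving_ofLp (Fin n)).setIntegral_preimage_emb
    (MeasurableEquiv.toLp 2 (Fin n → ℝ)).symm.measurableEmbedding f _

theorem integral_cell_planeWave (q : Fin n → ℤ) :
    ∫ x in cell n, planeWave (latticeVec q) x
      = if q = 0 then (((2 * Real.pi) ^ n : ℝ) : ℂ) else 0 := by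
  have h1 : ∀ x : EuclideanSpace ℝ (Fin n), planeWave (latticeVec q) x
      = (fun y : Fin n → ℝ => ∏ s, Complex.exp (Complex.I * ((q s * y s : ℝ) : ℂ)))
        (WithLp.ofLp x) := fun x => by
    simp only []
    rw [planeWave, ← Complex.exp_sum, ← Finset.mul_sum, ← Complex.ofReal_sum]
    congr 3
    simp [PiLp.inner_apply, latticeVec, mul_comm]
  simp only [h1]
  rw [setIntegral_cell (fun y : Fin n → ℝ => ∏ s, Complex.exp (Complex.I * ((q s * y s : ℝ) : ℂ))),
    MeasureTheory.volume_pi, MeasureTheory.Measure.restrict_pi_pi,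
    MeasureTheory.integral_fintype_prod_eq_prod
      (fun s y => Complex.exp (Complex.I * ((q s * y : ℝ) : ℂ)))]
  simp only [integral_exp_int_mul]
  split_ifs with hq
  · simp [hq]
  · obtain ⟨s, hs⟩ := Function.ne_iff.mp hq
    exact Finset.prod_eq_zero (Finset.mem_univ s) (if_neg hs)

instance isFiniteMeasure_restrict_cell :
    MeasureTheory.IsFiniteMeasure (MeasureTheory.volume.restrict (cell n)) := by
  have h := (PiLp.volume_preserving_ofLp (Fin n)).measure_preimage
    (s := Set.univ.pi fun _ : Fin n => Set.Icc 0 (2 * Real.pi))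
    (MeasurableSet.univ_pi fun _ => measurableSet_Icc).nullMeasurableSet
  rw [← cell_eq_preimage] at h
  refine MeasureTheory.isFiniteMeasure_restrict.mpr ?_
  rw [h]
  exact (isCompact_univ_pi fun _ => isCompact_Icc).measure_lt_top.ne

theorem fourierCoefficient_tsum {c : (Fin n → ℤ) → ℂ} (hc : Summable fun q => ‖c q‖)
    (q : Fin n → ℤ) :
    fourierCoefficient (fun x => ∑' i, c i * planeWave (latticeVec i) x) q = c q := by
  have hterm : ∀ (i : Fin n → ℤ) (x : EuclideanSpace ℝ (Fin n)),
      c i * planeWave (latticeVec i) x * planeWave (-latticeVec q) x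
        = c i * planeWave (latticeVec (i - q)) x := fun i x => by
    rw [mul_assoc, ← planeWave_add, sub_eq_add_neg, latticeVec_add, latticeVec_neg]
  have hint : ∀ i, MeasureTheory.IntegrableOn
      (fun x => c i * planeWave (latticeVec (i - q)) x) (cell n) := fun i => by
    refine MeasureTheory.Integrable.of_bound (C := ‖c i‖)
      (((contDiff_planeWave (N := 0) _).continuous.const_mul _).aestronglyMeasurable) ?_
    exact Filter.Eventually.of_forall fun x => by rw [norm_mul, norm_planeWave, mul_one]
  have hsum : Summable fun i => ∫ x in cell n, ‖c i * planeWave (latticeVec (i - q)) x‖ := by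
    simp only [norm_mul, norm_planeWave, mul_one, MeasureTheory.integral_const, smul_eq_mul]
    exact hc.mul_left _
  rw [fourierCoefficient]
  simp only [← tsum_mul_right, hterm]
  rw [← MeasureTheory.integral_tsum_of_summable_integral_norm hint hsum]
  simp only [MeasureTheory.integral_const_mul, integral_cell_planeWave, sub_eq_zero]
  rw [tsum_eq_single q (fun i hi => by simp [hi]), if_pos rfl]
  have : (((2 * Real.pi) ^ n : ℝ) : ℂ) ≠ 0 := by
    exact_mod_cast (pow_pos Real.two_pi_pos n).ne'
  field_simp

theorem starNorm_tsum (f : EllOne (Fin n → ℤ)) :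
    starNorm (fun x => ∑' i, f i * planeWave (latticeVec i) x) = ENNReal.ofReal ‖f‖ := by
  have hf := summable_norm_lp_one f
  rw [starNorm, norm_lp_one, ENNReal.ofReal_tsum_of_nonneg (fun _ => norm_nonneg _) hf]
  exact tsum_congr fun q => by rw [fourierCoefficient_tsum hf, ofReal_norm]

/-- The coefficients of a trigonometric polynomial as an element of `ℓ¹`. -/
def coefficients (v : (Fin n → ℤ) →₀ ℂ) : EllOne (Fin n → ℤ) :=
  lpOneMk v (summable_of_ne_finset_zero (s := v.support) fun q hq => by simpa using hq)

theorem coefficients_apply (v : (Fin n → ℤ) →₀ ℂ) (q : Fin n → ℤ) : coefficients v q = v q := rfl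

theorem trigPoly_eq_tsum (v : (Fin n → ℤ) →₀ ℂ) :
    trigPoly v = fun x => ∑' q, coefficients v q * planeWave (latticeVec q) x := by
  ext x
  rw [trigPoly, tsum_eq_sum (s := v.support)]
  · rfl
  · intro q hq
    rw [coefficients_apply, Finsupp.notMem_support_iff.mp hq, zero_mul]

theorem norm_coefficients_le {v : (Fin n → ℤ) →₀ ℂ} {M : ℝ≥0} (h : starNorm (trigPoly v) ≤ M) :
    ‖coefficients v‖ ≤ M := by
  rw [trigPoly_eq_tsum, starNorm_tsum] at h
  exact (ENNReal.ofReal_le_coe).mp h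

theorem isPeriodic_tsum (f : EllOne (Fin n → ℤ)) :
    IsPeriodic fun x => ∑' i, f i * planeWave (latticeVec i) x := by
  intro q x
  refine tsum_congr fun i => ?_
  have h : planeWave (latticeVec i) ((2 * Real.pi) • latticeVec q) = 1 := by
    have h1 : inner ℝ (latticeVec i) ((2 * Real.pi) • latticeVec q)
        = ((∑ s, i s * q s : ℤ) : ℝ) * (2 * Real.pi) := by
      rw [inner_smul_right]
      simp [PiLp.inner_apply, latticeVec, mul_comm]
    have h2 : Complex.I * ((((∑ s, i s * q s : ℤ) : ℝ) * (2 * Real.pi) : ℝ) : ℂ)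
        = ((∑ s, i s * q s : ℤ) : ℂ) * (2 * Real.pi * Complex.I) := by
      push_cast; ring
    rw [planeWave, h1, h2, Complex.exp_int_mul_two_pi_mul_I]
  rw [planeWave_add_right, h, mul_one]

theorem continuous_tsum_planeWave (f : EllOne (Fin n → ℤ)) :
    Continuous fun x => ∑' i, f i * planeWave (latticeVec i) x :=
  continuous_tsum (fun i => (contDiff_planeWave (N := 0) _).continuous.const_mul _)
    (summable_norm_lp_one f) fun i x => by rw [norm_mul, norm_planeWave, mul_one]

end Fourier

/-! ### Gaps of the free spectrum near a non-resonant quasimomentum -/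

section Gaps

open Filter

theorem eventually_const_mul_rpow_neg_le (C : ℝ) {y c : ℝ} (hy : 0 < y) (hc : 0 < c) :
    ∀ᶠ k : ℝ in atTop, C * k ^ (-y) ≤ c := by
  have h := (tendsto_rpow_neg_atTop hy).const_mul C
  rw [mul_zero] at h
  exact (h.eventually (gt_mem_nhds hc)).mono fun _ h => h.le

variable {n l : ℕ} {β δ k : ℝ}

theorem contourRadius_pos (hk : 0 < k) : 0 < contourRadius n l δ k := Real.rpow_pos_of_pos hk _

theorem freeEigenvalue_add_sub_mem_contour (hk : 0 < k) {θ : ℝ} (hθ : |θ| = 1) :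
    (((k ^ (2 * l) + θ * contourRadius n l δ k : ℝ)) : ℂ) ∈ contour n l δ k := by
  rw [contour, Set.mem_ofPred_eq, ← Complex.ofReal_sub, Complex.norm_real, Real.norm_eq_abs,
    add_sub_cancel_left, abs_mul, hθ, one_mul, abs_of_pos (contourRadius_pos hk)]

/-- At a non-resonant quasimomentum every free eigenvalue but one keeps the distance `2ρ` from
`k^{2l}`, `ρ` being the radius of the contour, and the products of gaps at neighbouring indices
are large. -/
theorem gaps_of_mem_nonResonantSet (hk : 0 < k) {t : EuclideanSpace ℝ (Fin n)}
    (ht : t ∈ nonResonantSet n l k β δ) :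
    ∃ j : Fin n → ℤ, freeEigenvalue l t j = k ^ (2 * l) ∧
      (∀ i, i ≠ j → 2 * contourRadius n l δ k ≤ |freeEigenvalue l t i - k ^ (2 * l)|) ∧
      (∀ q, q ≠ 0 → ‖latticeVec q‖ < k ^ β → k ^ (2 * gammaTwo n l β δ)
        ≤ 300 * (contourRadius n l δ k * |freeEigenvalue l t (j + q) - k ^ (2 * l)|)) ∧
      ∀ i q, q ≠ 0 → ‖latticeVec q‖ < k ^ β → i ≠ j → i + q ≠ j →
        k ^ (2 * gammaTwo n l β δ) ≤ 450 * (|freeEigenvalue l t i - k ^ (2 * l)|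
          * |freeEigenvalue l t (i + q) - k ^ (2 * l)|) := by
  obtain ⟨-, ⟨j, hj, huniq⟩, hz⟩ := ht
  have hρ : 0 < contourRadius n l δ k := contourRadius_pos hk
  set ρ := contourRadius n l δ k
  set x : (Fin n → ℤ) → ℝ := fun i => freeEigenvalue l t i - k ^ (2 * l) with hx
  have hnorm : ∀ i (θ : ℝ), ‖(freeEigenvalue l t i : ℂ) - ((k ^ (2 * l) + θ * ρ : ℝ) : ℂ)‖
      = |x i - θ * ρ| := fun i θ => by
    rw [← Complex.ofReal_sub, Complex.norm_real, Real.norm_eq_abs, hx, sub_sub]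
  have hplus := hz _ (freeEigenvalue_add_sub_mem_contour hk (θ := 1) (by simp))
  have hminus := hz _ (freeEigenvalue_add_sub_mem_contour hk (θ := -1) (by simp))
  -- A real number at distance at least `ρ` from both `±ρ` is zero or has modulus at least `2ρ`.
  have hgap : ∀ i, i ≠ j → 2 * ρ ≤ |x i| := by
    intro i hi
    have h0 : x i ≠ 0 := fun h0 => hi (huniq i (sub_eq_zero.mp h0))
    have h1 := hplus.1 i
    have h2 := hminus.1 i
    rw [hnorm] at h1 h2
    rcases lt_or_gt_of_ne h0 with h | h
    · rw [abs_of_neg h]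
      rcases abs_cases (x i - -1 * ρ) with ⟨h3, _⟩ | ⟨h3, _⟩ <;> rw [h3] at h2 <;> linarith
    · rw [abs_of_pos h]
      rcases abs_cases (x i - 1 * ρ) with ⟨h3, _⟩ | ⟨h3, _⟩ <;> rw [h3] at h1 <;> linarith
  have hle : ∀ i, |x i - 1 * ρ| ≤ |x i| + ρ := fun i => by
    refine (abs_sub _ _).trans_eq ?_
    rw [one_mul, abs_of_pos hρ]
  have hxj : x j = 0 := sub_eq_zero.mpr hj
  have hprod : ∀ i q : Fin n → ℤ, q ≠ 0 → ‖latticeVec q‖ < k ^ β →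
      k ^ (2 * gammaTwo n l β δ) < 200 * |x i - 1 * ρ| * |x (i + q) - 1 * ρ| := by
    intro i q hq hqβ
    rw [← hnorm, ← hnorm]
    exact hplus.2 i q hq hqβ
  have hle' : ∀ i, i ≠ j → |x i - 1 * ρ| ≤ 3 / 2 * |x i| := fun i hi => by
    linarith [hle i, hgap i hi]
  refine ⟨j, hj, hgap, fun q hq hqβ => ?_, fun i q hq hqβ hi hiq => ?_⟩
  · refine (hprod j q hq hqβ).le.trans ?_
    have h1 := hle' (j + q) (by simpa using hq)
    rw [hxj, zero_sub, abs_neg, one_mul, abs_of_pos hρ]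
    have := mul_le_mul_of_nonneg_left h1 hρ.le
    rw [one_mul] at this
    change _ ≤ 300 * (ρ * |x (j + q)|)
    linarith
  · refine (hprod i q hq hqβ).le.trans ?_
    have := mul_le_mul (hle' i hi) (hle' _ hiq) (abs_nonneg _) (by positivity)
    change _ ≤ 450 * (|x i| * |x (i + q)|)
    linarith

/-- Under a displacement of the quasimomentum by less than `k^{-n+1-2δ}` the free eigenvalues
change little in comparison with their distance to the contour. -/
theorem eventually_freeEigenvalue_sub_le (n l : ℕ) (hn : 1 ≤ n) (hl : 1 ≤ l) {δ : ℝ} (hδ : 0 < δ) :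
    ∀ᶠ k : ℝ in atTop, ∀ (t t₀ : EuclideanSpace ℝ (Fin n)) (i : Fin n → ℤ),
      dist t t₀ < k ^ (-(n : ℝ) + 1 - 2 * δ) →
      |freeEigenvalue l t i - freeEigenvalue l t₀ i|
        ≤ (|freeEigenvalue l t₀ i - k ^ (2 * l)| + contourRadius n l δ k) / 32 := by
  filter_upwards [eventually_const_mul_rpow_neg_le (2 * l * 3 ^ (2 * l - 1)) hδ
      (show (0 : ℝ) < 1 / 32 by norm_num), eventually_ge_atTop (1 : ℝ),
      eventually_ge_atTop (2 * l * 2 ^ (2 * l - 1) * 64 : ℝ)] with k hkδ hk1 hkl t t₀ i hdist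
  have hk0 : 0 < k := by linarith
  set η := k ^ (-(n : ℝ) + 1 - 2 * δ) with hη
  have hη1 : η ≤ 1 := Real.rpow_le_one_of_one_le_of_nonpos hk1 (by
    have : (1 : ℝ) ≤ n := by exact_mod_cast hn
    linarith)
  have hρ : 0 < contourRadius n l δ k := contourRadius_pos hk0
  set b := ‖momentum t₀ i‖ with hb
  set a := ‖momentum t i‖ with ha
  have hb0 : 0 ≤ b := norm_nonneg _
  have hab : |a - b| ≤ η := by
    refine (abs_norm_sub_norm_le _ _).trans ?_
    rw [momentum, momentum, add_sub_add_right_eq_sub, ← dist_eq_norm]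
    exact hdist.le
  have hη0 : 0 ≤ η := (abs_nonneg _).trans hab
  have hab' : a ≤ b + η := by linarith [le_abs_self (a - b)]
  have hpow : |a ^ (2 * l) - b ^ (2 * l)| ≤ η * (2 * l) * (b + η) ^ (2 * l - 1) := by
    refine (abs_pow_sub_pow_le a b (2 * l)).trans ?_
    push_cast
    gcongr
    rw [abs_of_nonneg (norm_nonneg _), abs_of_nonneg hb0]
    exact max_le hab' (by linarith)
  change |a ^ (2 * l) - b ^ (2 * l)| ≤ (|b ^ (2 * l) - k ^ (2 * l)| + contourRadius n l δ k) / 32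
  have h2l : 2 * l - 1 + 1 = 2 * l := by omega
  -- For `b ≤ 2k` the change is `O(ρ k^{-δ})`; for `b > 2k` the gap itself is of the order `b^{2l}`.
  rcases le_or_gt b (2 * k) with hbk | hbk
  · have h1 : (b + η) ^ (2 * l - 1) ≤ (3 * k) ^ (2 * l - 1) := by
      gcongr; linarith
    have h2 : k ^ (2 * l - 1) * η = contourRadius n l δ k * k ^ (-δ) := by
      rw [hη, contourRadius, ← Real.rpow_natCast, ← Real.rpow_add hk0, ← Real.rpow_add hk0,
        Nat.cast_sub (by omega)]
      congr 1
      push_cast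
      ring
    have h3 : |a ^ (2 * l) - b ^ (2 * l)| ≤ contourRadius n l δ k / 32 := by
      calc _ ≤ η * (2 * l) * (3 * k) ^ (2 * l - 1) := hpow.trans (by gcongr)
        _ = contourRadius n l δ k * (2 * l * 3 ^ (2 * l - 1) * k ^ (-δ)) := by
          rw [mul_pow]
          linear_combination (2 * l * 3 ^ (2 * l - 1) : ℝ) * h2
        _ ≤ contourRadius n l δ k * (1 / 32) := by gcongr
        _ = _ := by ring
    linarith [abs_nonneg (b ^ (2 * l) - k ^ (2 * l))]
  · have h1 : (b + η) ^ (2 * l - 1) ≤ (2 * b) ^ (2 * l - 1) := by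
      gcongr; linarith
    have h2 : k ^ (2 * l) ≤ b ^ (2 * l) / 4 := by
      have : (2 * k) ^ (2 * l) ≤ b ^ (2 * l) := by gcongr
      rw [mul_pow] at this
      have h4 : (4 : ℝ) ≤ 2 ^ (2 * l) := by
        calc (4 : ℝ) = 2 ^ 2 := by norm_num
          _ ≤ 2 ^ (2 * l) := pow_le_pow_right₀ (by norm_num) (by omega)
      nlinarith [pow_pos hk0 (2 * l)]
    have h3 : |a ^ (2 * l) - b ^ (2 * l)| ≤ b ^ (2 * l) / 64 := by
      calc _ ≤ η * (2 * l) * (2 * b) ^ (2 * l - 1) := hpow.trans (by gcongr)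
        _ ≤ 1 * (2 * l) * (2 * b) ^ (2 * l - 1) := by gcongr
        _ = (2 * l * 2 ^ (2 * l - 1) * 64) * b ^ (2 * l - 1) / 64 := by rw [mul_pow]; ring
        _ ≤ b * b ^ (2 * l - 1) / 64 := by gcongr; linarith
        _ = b ^ (2 * l) / 64 := by rw [← pow_succ', h2l]
    have h4 := le_abs_self (b ^ (2 * l) - k ^ (2 * l))
    have h5 : 0 ≤ b ^ (2 * l) := by positivity
    linarith

/-- Near a non-resonant quasimomentum there is a single free eigenvalue inside the contour; the
others keep a distance from it, and the products of gaps at neighbouring indices are large. -/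
theorem eventually_gaps (n l : ℕ) (hn : 1 ≤ n) (hl : 1 ≤ l) (β : ℝ) {δ : ℝ} (hδ : 0 < δ) :
    ∀ᶠ k : ℝ in atTop, ∀ t ∈ nonResonantNhd n l k β δ, ∃ j : Fin n → ℤ,
      (∀ i, |freeEigenvalue l t i - k ^ (2 * l)| < contourRadius n l δ k ↔ i = j) ∧
      (∀ q, q ≠ 0 → contourRadius n l δ k
        ≤ |freeEigenvalue l t (j + q) - freeEigenvalue l t j|) ∧
      (∀ q, q ≠ 0 → ‖latticeVec q‖ < k ^ β → k ^ (2 * gammaTwo n l β δ) ≤ 900 *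
        (contourRadius n l δ k * |freeEigenvalue l t (j + q) - freeEigenvalue l t j|)) ∧
      ∀ q q', q ≠ 0 → q' ≠ 0 → q ≠ q' → ‖latticeVec (q - q')‖ < k ^ β →
        k ^ (2 * gammaTwo n l β δ) ≤ 900 * (|freeEigenvalue l t (j + q) - freeEigenvalue l t j|
          * |freeEigenvalue l t (j + q') - freeEigenvalue l t j|) := by
  filter_upwards [eventually_freeEigenvalue_sub_le n l hn hl hδ, eventually_gt_atTop (0 : ℝ)] with
    k hk hk0 t ht
  obtain ⟨-, t₀, ht₀, hdist⟩ := ht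
  obtain ⟨j, hj, hgap, hprod₁, hprod₂⟩ := gaps_of_mem_nonResonantSet hk0 ht₀
  have hρ : 0 < contourRadius n l δ k := contourRadius_pos hk0
  set ρ := contourRadius n l δ k
  have hpert := fun i => hk t t₀ i hdist
  have hpj := hpert j
  rw [hj, sub_self, abs_zero, zero_add] at hpj
  have hsep : ∀ i, i ≠ j → 7 / 8 * |freeEigenvalue l t₀ i - k ^ (2 * l)|
      ≤ |freeEigenvalue l t i - freeEigenvalue l t j| := by
    intro i hi
    have h1 := hgap i hi
    have h2 := hpert i
    have h3 : |freeEigenvalue l t₀ i - k ^ (2 * l)|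
        ≤ |freeEigenvalue l t i - freeEigenvalue l t j|
          + |freeEigenvalue l t i - freeEigenvalue l t₀ i|
          + |freeEigenvalue l t j - k ^ (2 * l)| := by
      have e : freeEigenvalue l t₀ i - k ^ (2 * l)
          = (freeEigenvalue l t i - freeEigenvalue l t j)
            - (freeEigenvalue l t i - freeEigenvalue l t₀ i)
            + (freeEigenvalue l t j - k ^ (2 * l)) := by ring
      rw [e]
      exact (abs_add_le _ _).trans (add_le_add_left (abs_sub _ _) _)
    linarith
  have hjq : ∀ q, q ≠ 0 → j + q ≠ j := fun q hq => by simpa using hq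
  refine ⟨j, fun i => ⟨fun hi => ?_, ?_⟩, fun q hq => ?_, fun q hq hqβ => ?_,
    fun q q' hq hq' hqq hqβ => ?_⟩
  · by_contra hij
    have h1 := hgap i hij
    have h2 := hpert i
    have h3 := abs_sub_abs_le_abs_sub (freeEigenvalue l t₀ i - k ^ (2 * l))
      (freeEigenvalue l t i - k ^ (2 * l))
    rw [sub_sub_sub_cancel_right, abs_sub_comm (freeEigenvalue l t₀ i) (freeEigenvalue l t i)] at h3
    linarith
  · rintro rfl
    linarith
  · linarith [hsep _ (hjq q hq), hgap _ (hjq q hq)]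
  · refine (hprod₁ q hq hqβ).trans ?_
    have := mul_le_mul_of_nonneg_left (hsep _ (hjq q hq)) hρ.le
    have h0 : 0 ≤ ρ * |freeEigenvalue l t₀ (j + q) - k ^ (2 * l)| := by positivity
    linarith
  · have h := hprod₂ (j + q') (q - q') (sub_ne_zero.mpr hqq) hqβ (hjq q' hq')
      (by rw [add_add_sub_cancel]; exact hjq q hq)
    rw [add_add_sub_cancel] at h
    refine h.trans ?_
    have := mul_le_mul (hsep _ (hjq q hq)) (hsep _ (hjq q' hq')) (by positivity) (abs_nonneg _)
    have h0 : 0 ≤ |freeEigenvalue l t₀ (j + q') - k ^ (2 * l)|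
      * |freeEigenvalue l t₀ (j + q) - k ^ (2 * l)| := by positivity
    linarith

end Gaps

/-! ### The solution near the non-resonant set -/

section Solution

open Filter

variable {n l : ℕ}

/-- A solution of the equation for the Fourier coefficients yields a classical solution. -/
theorem isQuasiPeriodicSolution_of_coefficients {v : (Fin n → ℤ) →₀ ℂ}
    {t : EuclideanSpace ℝ (Fin n)} {j : Fin n → ℤ} {σ lam : ℝ} {A : ℂ}
    {c : EllOne (Fin n → ℤ)}
    (h : ∀ q, (freeEigenvalue l t (j + q) : ℂ) * c q + (conv (coefficients v) c q
      + ((σ * ‖A‖ ^ 2 : ℝ) : ℂ) * cubic c q) = lam * c q) :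
    IsQuasiPeriodicSolution l (trigPoly v) σ t lam
      fun x => A * planeWave (momentum t j) x * ∑' q, c q * planeWave (latticeVec q) x := by
  have hu : (fun x => A * planeWave (momentum t j) x * ∑' q, c q * planeWave (latticeVec q) x)
      = fun x => ∑' q, A * c q * planeWave (momentum t (j + q)) x := by
    ext x
    rw [← tsum_mul_left]
    refine tsum_congr fun q => ?_
    rw [momentum, momentum, latticeVec_add, ← add_assoc, planeWave_add _ (latticeVec q)]
    ring
  have hc := summable_norm_lp_one c
  -- The equation expresses `p_{j+q}^{2l} c_q` through elements of `ℓ¹`.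
  have hPc : Summable fun q => ‖(freeEigenvalue l t (j + q) : ℂ) * c q‖ := by
    have hb : Summable fun q => ‖(lam : ℂ)‖ * ‖c q‖ + (‖conv (coefficients v) c q‖
        + ‖((σ * ‖A‖ ^ 2 : ℝ) : ℂ)‖ * ‖cubic c q‖) :=
      (hc.mul_left _).add ((summable_norm_lp_one _).add ((summable_norm_lp_one _).mul_left _))
    refine hb.of_nonneg_of_le (fun _ => norm_nonneg _) fun q => ?_
    rw [eq_sub_of_add_eq (h q)]
    refine (norm_sub_le _ _).trans ?_
    rw [norm_mul]
    gcongr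
    refine (norm_add_le _ _).trans ?_
    rw [norm_mul]
  have hsum : Summable fun q => ‖A * c q‖ * (1 + ‖momentum t (j + q)‖) ^ (2 * l) := by
    refine (((hc.add hPc).mul_left (2 ^ (2 * l - 1))).mul_left ‖A‖).of_nonneg_of_le
      (fun _ => by positivity) fun q => ?_
    have h1 := add_pow_le zero_le_one (norm_nonneg (momentum t (j + q))) (2 * l)
    rw [one_pow] at h1
    rw [norm_mul, norm_mul, Complex.norm_real, freeEigenvalue, norm_pow, norm_norm]
    calc ‖A‖ * ‖c q‖ * (1 + ‖momentum t (j + q)‖) ^ (2 * l)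
        ≤ ‖A‖ * ‖c q‖ * (2 ^ (2 * l - 1) * (1 + ‖momentum t (j + q)‖ ^ (2 * l))) := by gcongr
      _ = _ := by ring
  refine ⟨?_, fun x _ => ?_, ?_⟩
  · rw [hu]
    exact contDiff_tsum_planeWave hsum
  · have hlap : negLaplacianPow l (fun x => A * planeWave (momentum t j) x
        * ∑' q, c q * planeWave (latticeVec q) x) x = A * planeWave (momentum t j) x
        * ∑' q, (freeEigenvalue l t (j + q) : ℂ) * c q * planeWave (latticeVec q) x := by
      rw [hu, negLaplacianPow_tsum_planeWave l _ hsum, ← tsum_mul_left]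
      refine tsum_congr fun q => ?_
      rw [momentum, momentum, latticeVec_add, ← add_assoc, planeWave_add _ (latticeVec q),
        freeEigenvalue, momentum, latticeVec_add, ← add_assoc]
      ring
    set χ : (Fin n → ℤ) → ℂ := fun q => planeWave (latticeVec q) x with hχ
    have hχ1 : ∀ q, ‖χ q‖ = 1 := fun q => norm_planeWave _ _
    have hχadd : ∀ q q', χ (q + q') = χ q * χ q' := fun q q' => by
      rw [hχ]
      simp only [latticeVec_add, planeWave_add]
    have hχneg : ∀ q, χ (-q) = (starRingEnd ℂ) (χ q) := fun q => by
      rw [hχ]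
      simp only [latticeVec_neg, planeWave_neg]
    have hs0 : Summable fun q => (freeEigenvalue l t (j + q) : ℂ) * c q * χ q :=
      Summable.of_norm (by simpa [hχ1] using hPc)
    have hs1 := summable_mul_character hχ1 (conv (coefficients v) c)
    have hs2 := (summable_mul_character hχ1 (cubic c)).mul_left ((σ * ‖A‖ ^ 2 : ℝ) : ℂ)
    have hmain : ∑' q, (freeEigenvalue l t (j + q) : ℂ) * c q * χ q
        + ((∑' q, coefficients v q * χ q) * (∑' q, c q * χ q) + ((σ * ‖A‖ ^ 2 : ℝ) : ℂ)
          * (((‖∑' q, c q * χ q‖ ^ 2 : ℝ) : ℂ) * ∑' q, c q * χ q))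
        = lam * ∑' q, c q * χ q := by
      rw [← tsum_conv_mul_character hχ1 hχadd, ← tsum_cubic_mul_character hχ1 hχadd hχneg,
        ← tsum_mul_left, ← hs1.tsum_add hs2, ← hs0.tsum_add (hs1.add hs2), ← tsum_mul_left]
      refine tsum_congr fun q => ?_
      linear_combination χ q * h q
    have hV : trigPoly v x = ∑' q, coefficients v q * χ q := by rw [trigPoly_eq_tsum]
    have hnorm : ‖A * planeWave (momentum t j) x * ∑' q, c q * planeWave (latticeVec q) x‖ ^ 2
        = ‖A‖ ^ 2 * ‖∑' q, c q * χ q‖ ^ 2 := by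
      rw [norm_mul, norm_mul, norm_planeWave, mul_one, mul_pow]
    rw [hlap, hV, hnorm]
    push_cast at hmain ⊢
    linear_combination A * planeWave (momentum t j) x * hmain
  · rw [hu]
    exact quasiPeriodicBC_tsum_planeWave hsum

/-- The rescaled equation at a quasimomentum with good gaps: after division by the contour radius
`ρ`, the weights `m = √|a|` make convolution by the potential an operator of norm at most `κ M`, and
the first-order correction is at most `κ² ρ M`. -/
theorem scaledData_of_gaps {v : (Fin n → ℤ) →₀ ℂ} {t : EuclideanSpace ℝ (Fin n)}
    {j : Fin n → ℤ} {ρ κ M R : ℝ} (hρ : 0 < ρ) (hκ : 0 < κ) (hv0 : v 0 = 0)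
    (hM : ‖coefficients v‖ ≤ M) (hR : ∀ q ∈ v.support, ‖latticeVec q‖ < R)
    (h₁ : ∀ q, q ≠ 0 → ρ ≤ |freeEigenvalue l t (j + q) - freeEigenvalue l t j|)
    (h₂ : ∀ q, q ≠ 0 → ‖latticeVec q‖ < R →
      1 ≤ κ ^ 2 * (ρ * |freeEigenvalue l t (j + q) - freeEigenvalue l t j|))
    (h₃ : ∀ q q', q ≠ 0 → q' ≠ 0 → q ≠ q' → ‖latticeVec (q - q')‖ < R →
      1 ≤ κ ^ 2 * (|freeEigenvalue l t (j + q) - freeEigenvalue l t j|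
          * |freeEigenvalue l t (j + q') - freeEigenvalue l t j|)) :
    ∃ m : (Fin n → ℤ) → ℝ,
      ScaledData (fun q => (freeEigenvalue l t (j + q) - freeEigenvalue l t j) / ρ) m
        (((ρ⁻¹ : ℝ) : ℂ) • coefficients v) (fun q => κ * ‖v q‖) (κ * M) ∧
      ∑' q, ‖(((ρ⁻¹ : ℝ) : ℂ) • coefficients v) q‖ / m q ^ 2 ≤ κ ^ 2 * ρ * M := by
  -- With the value `ρ` at `0`, the weight `√(D / ρ)` is `1` there and both kinds of gap conditions
  -- take the same form.
  set D : (Fin n → ℤ) → ℝ :=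
    fun q => if q = 0 then ρ else |freeEigenvalue l t (j + q) - freeEigenvalue l t j| with hD
  have hD0 : D 0 = ρ := if_pos rfl
  have hDne : ∀ q, q ≠ 0 → D q = |freeEigenvalue l t (j + q) - freeEigenvalue l t j| :=
    fun q hq => if_neg hq
  have hDρ : ∀ q, ρ ≤ D q := fun q => by
    by_cases hq : q = 0
    · rw [hq, hD0]
    · rw [hDne q hq]; exact h₁ q hq
  have hDpos : ∀ q, 0 < D q := fun q => hρ.trans_le (hDρ q)
  have hsq : ∀ q, √(D q / ρ) ^ 2 = D q / ρ := fun q =>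
    Real.sq_sqrt (div_pos (hDpos q) hρ).le
  have hv : ∀ q q', v (q - q') ≠ 0 → 1 ≤ κ ^ 2 * (D q * D q') := by
    intro q q' hqq
    have hne : q ≠ q' := fun h => hqq (by rw [h, sub_self, hv0])
    have hlt := hR _ (Finsupp.mem_support_iff.mpr hqq)
    by_cases hq : q = 0
    · have hq' : q' ≠ 0 := fun h => hne (hq.trans h.symm)
      rw [hq, zero_sub, latticeVec_neg, norm_neg] at hlt
      rw [hq, hD0, hDne q' hq']
      exact h₂ q' hq' hlt
    · by_cases hq' : q' = 0
      · rw [hq', sub_zero] at hlt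
        rw [hq', hD0, hDne q hq, mul_comm _ ρ]
        exact h₂ q hq hlt
      · rw [hDne q hq, hDne q' hq']
        exact h₃ q q' hq hq' hne hlt
  have hbn : ∀ q, ‖(((ρ⁻¹ : ℝ) : ℂ) • coefficients v) q‖ = ρ⁻¹ * ‖v q‖ := fun q => by
    rw [EllOne.smul_apply, norm_mul, Complex.norm_real, Real.norm_of_nonneg (inv_pos.mpr hρ).le,
      coefficients_apply]
  have hvs : Summable fun q => ‖v q‖ := summable_norm_lp_one (coefficients v)
  have hvM : ∑' q, ‖v q‖ ≤ M := (norm_lp_one (coefficients v)).symm.trans_le hM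
  refine ⟨fun q => √(D q / ρ), ⟨by simp, by simp [hD0, hρ.ne'], fun q => ?_, fun q hq => ?_,
    hvs.mul_left κ, ?_, fun q q' => ?_⟩, ?_⟩
  · exact Real.one_le_sqrt.mpr ((one_le_div hρ).mpr (hDρ q))
  · rw [hsq, hDne q hq, abs_div, abs_of_pos hρ]
  · rw [tsum_mul_left]
    gcongr
  · rw [hbn]
    by_cases hqq : v (q - q') = 0
    · simp [hqq]
    · have h1 : 1 ≤ κ * (√(D q) * √(D q')) := by
        rw [← abs_of_nonneg (show 0 ≤ κ * (√(D q) * √(D q')) by positivity),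
          ← one_le_sq_iff_one_le_abs, mul_pow, mul_pow, Real.sq_sqrt (hDpos q).le,
          Real.sq_sqrt (hDpos q').le]
        exact hv q q' hqq
      have h2 : √(D q / ρ) * √(D q' / ρ) = √(D q) * √(D q') * ρ⁻¹ := by
        rw [Real.sqrt_div (hDpos q).le, Real.sqrt_div (hDpos q').le]
        field_simp
        rw [Real.sq_sqrt hρ.le]
        ring
      rw [h2]
      have h3 : 0 ≤ ρ⁻¹ * ‖v (q - q')‖ := by positivity
      nlinarith
  · have hle : ∀ q, ‖(((ρ⁻¹ : ℝ) : ℂ) • coefficients v) q‖ / √(D q / ρ) ^ 2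
        ≤ κ ^ 2 * ρ * ‖v q‖ := fun q => by
      rw [hbn, hsq]
      by_cases hq : v q = 0
      · simp [hq]
      · have h1 := hv q 0 (by rwa [sub_zero])
        rw [hD0] at h1
        have h2 : ρ⁻¹ * ‖v q‖ / (D q / ρ) = ‖v q‖ / D q := by field_simp
        rw [h2, div_le_iff₀ (hDpos q)]
        nlinarith [norm_nonneg (v q)]
    have hs : Summable fun q => κ ^ 2 * ρ * ‖v q‖ := hvs.mul_left _
    have hs' := hs.of_nonneg_of_le (fun q => by positivity) hle
    refine (hs'.tsum_le_tsum hle hs).trans ?_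
    rw [tsum_mul_left]
    gcongr

end Solution

end Polyharmonic


open Polyharmonic Filter in
theorem mainTheorem1 (n l : ℕ) (hn : 2 ≤ n) (hl : n + 1 < 4 * l)
    (β δ : ℝ) (hβ₀ : 0 < β) (hβ₁ : β < 1)
    (hδ₀ : 0 < δ) (hδ₁ : 2 * δ < ((n : ℝ) - 1) * (1 - β))
    (hγ : 0 < Polyharmonic.gammaTwo n l β δ) (M : ℝ≥0) :
    ∃ k₁ C : ℝ, 0 < k₁ ∧ 0 < C ∧
      ∀ (v : (Fin n → ℤ) →₀ ℂ),
        v 0 = 0 →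
        (∀ q, v (-q) = (starRingEnd ℂ) (v q)) →
        Polyharmonic.starNorm (Polyharmonic.trigPoly v) ≤ (M : ℝ≥0∞) →
        ∀ k : ℝ, k₁ < k →
          (∀ q ∈ v.support, ‖Polyharmonic.latticeVec q‖ < k ^ β) →
          ∀ t ∈ Polyharmonic.nonResonantNhd n l k β δ,
            ∃ j : Fin n → ℤ,
              (∀ i : Fin n → ℤ,
                |Polyharmonic.freeEigenvalue l t i - k ^ (2 * l)|
                  < Polyharmonic.contourRadius n l δ k ↔ i = j) ∧
              ∀ (σ : ℝ) (A : ℂ),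
                |σ| * ‖A‖ ^ 2 < k ^ (Polyharmonic.gammaZero n l δ - δ) →
                ∃ (u w : EuclideanSpace ℝ (Fin n) → ℂ) (lam : ℝ),
                  Polyharmonic.IsQuasiPeriodicSolution l (Polyharmonic.trigPoly v) σ t lam u ∧
                  (∀ x, u x = A * Polyharmonic.planeWave (Polyharmonic.momentum t j) x
                    * (1 + w x)) ∧
                  Continuous w ∧
                  Polyharmonic.IsPeriodic w ∧
                  Polyharmonic.starNorm w
                    ≤ ENNReal.ofReal (k ^ (-Polyharmonic.gammaTwo n l β δ)) ∧
                  |lam - (Polyharmonic.freeEigenvalue l t j + σ * ‖A‖ ^ 2)|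
                    ≤ C * ((Polyharmonic.contourRadius n l δ k + σ * ‖A‖ ^ 2)
                      * k ^ (-(2 * Polyharmonic.gammaTwo n l β δ))) := by
  have hexp : 0 < ((n : ℝ) - 1) * (1 - β) / 2 := by linarith
  obtain ⟨k₀, hk₀⟩ := eventually_atTop.mp
    (((((eventually_gaps n l (by omega) (by omega) β hδ₀).and
      (eventually_const_mul_rpow_neg_le (30 * M) hγ (show (0 : ℝ) < 1 / 100 by norm_num))).and
      (eventually_const_mul_rpow_neg_le 1 (mul_pos two_pos hδ₀)
        (show (0 : ℝ) < 1 / 100 by norm_num))).and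
      (eventually_const_mul_rpow_neg_le (14400 * M ^ 2) hγ (show (0 : ℝ) < 1 / 2 by norm_num))).and
      (eventually_const_mul_rpow_neg_le (3600 * M) hexp (show (0 : ℝ) < 1 / 2 by norm_num)))
  refine ⟨max k₀ 1, 2 * (3600 * M ^ 2 + 4), by positivity, by positivity,
    fun v hv0 hvconj hvM k hk hvk t ht => ?_⟩
  obtain ⟨⟨⟨⟨hgaps, hk1⟩, hk2⟩, hk3⟩, hk4⟩ := hk₀ k ((le_max_left _ _).trans hk.le)
  have hkpos : 0 < k := one_pos.trans ((le_max_right _ _).trans_lt hk)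
  obtain ⟨j, hj, h₁, h₂, h₃⟩ := hgaps t ht
  refine ⟨j, hj, fun σ A hσ => ?_⟩
  have hρ : 0 < contourRadius n l δ k := contourRadius_pos hkpos
  set ρ := contourRadius n l δ k with hρdef
  set γ := gammaTwo n l β δ with hγdef
  -- The factor `30` is the square root of the constant `900` in the gap conditions.
  set κ := 30 * k ^ (-γ) with hκdef
  have hkγ : 0 < k ^ (-γ) := Real.rpow_pos_of_pos hkpos _
  have hκ : 0 < κ := by positivity
  have hk2γ : k ^ (-(2 * γ)) = (k ^ (-γ)) ^ 2 := by
    rw [← Real.rpow_natCast, ← Real.rpow_mul hkpos.le]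
    congr 1
    push_cast
    ring
  have hκγ : ∀ X : ℝ, k ^ (2 * γ) ≤ 900 * X → 1 ≤ κ ^ 2 * X := fun X hX => by
    have h1 : k ^ (-(2 * γ)) * k ^ (2 * γ) = 1 := by
      rw [← Real.rpow_add hkpos, neg_add_cancel, Real.rpow_zero]
    have h2 := mul_le_mul_of_nonneg_left hX (Real.rpow_pos_of_pos hkpos (-(2 * γ))).le
    rw [h1, hk2γ] at h2
    rw [hκdef, mul_pow]
    linarith
  obtain ⟨m, hdata, hε₂⟩ := scaledData_of_gaps hρ hκ hv0 (norm_coefficients_le hvM) hvk h₁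
    (fun q hq hqk => hκγ _ (h₂ q hq hqk)) (fun q q' hq hq' hqq hqk => hκγ _ (h₃ q q' hq hq' hqq hqk))
  set s := σ * ‖A‖ ^ 2 / ρ with hs
  have hsρ : σ * ‖A‖ ^ 2 = ρ * s := by rw [hs]; field_simp
  have hs1 : |s| ≤ 1 / 100 := by
    have h1 : k ^ (gammaZero n l δ - δ) = k ^ (-(2 * δ)) * ρ := by
      rw [hρdef, contourRadius, ← Real.rpow_add hkpos, gammaZero]
      congr 1
      ring
    rw [hs, abs_div, abs_of_pos hρ, div_le_iff₀ hρ, abs_mul, abs_of_nonneg (sq_nonneg ‖A‖)]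
    refine hσ.le.trans ?_
    rw [h1]
    gcongr
    linarith
  have hb : reflectConj (((ρ⁻¹ : ℝ) : ℂ) • coefficients v) = ((ρ⁻¹ : ℝ) : ℂ) • coefficients v := by
    rw [reflectConj_smul]
    congr 1
    ext q
    rw [reflectConj_apply, coefficients_apply, coefficients_apply, hvconj, Complex.conj_conj]
  obtain ⟨w, ℓ, heq, hw, hℓ⟩ := hdata.exists_solution (by rw [hκdef]; linarith) hs1
    (by rw [EllOne.smul_apply, coefficients_apply, hv0, mul_zero]) hb hε₂
  have hwγ : ‖w‖ ≤ k ^ (-γ) := by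
    -- The exponents satisfy `(2l - n - δ) - γ₂ = -(n - 1)(1 - β) / 2`.
    have h1 : ρ * k ^ (-γ) = k ^ (-(((n : ℝ) - 1) * (1 - β) / 2)) := by
      rw [hρdef, contourRadius, ← Real.rpow_add hkpos, hγdef, gammaTwo]
      congr 1
      ring
    rw [← h1] at hk4
    refine hw.trans ?_
    rw [hκdef]
    nlinarith
  refine ⟨fun x => A * planeWave (momentum t j) x
      * ∑' q, (convOne + w : EllOne (Fin n → ℤ)) q * planeWave (latticeVec q) x,
    fun x => ∑' q, w q * planeWave (latticeVec q) x, freeEigenvalue l t j + ρ * ℓ, ?_, fun x => ?_,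
    continuous_tsum_planeWave w, isPeriodic_tsum w, ?_, ?_⟩
  · refine isQuasiPeriodicSolution_of_coefficients fun q => ?_
    have h1 := heq q
    have hρ0 : (ρ : ℂ) ≠ 0 := by exact_mod_cast hρ.ne'
    rw [smul_conv, EllOne.smul_apply] at h1
    rw [hsρ]
    push_cast at h1 ⊢
    have h2 := congrArg ((ρ : ℂ) * ·) h1
    simp only [mul_add] at h2
    rw [← mul_assoc (ρ : ℂ) (_ / _), mul_div_cancel₀ _ hρ0, mul_inv_cancel_left₀ hρ0] at h2
    linear_combination h2
  · have hχ1 : ∀ q : Fin n → ℤ, ‖planeWave (latticeVec q) x‖ = 1 := fun q => norm_planeWave _ _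
    simp only [EllOne.add_apply, add_mul]
    rw [(summable_mul_character hχ1 _).tsum_add (summable_mul_character hχ1 w),
      tsum_convOne_mul_character (by rw [latticeVec_zero, planeWave_zero])]
  · rw [starNorm_tsum]
    exact ENNReal.ofReal_le_ofReal hwγ
  · have h1 : freeEigenvalue l t j + ρ * ℓ - (freeEigenvalue l t j + σ * ‖A‖ ^ 2)
        = ρ * (ℓ - s) := by rw [hsρ]; ring
    rw [h1, abs_mul, abs_of_pos hρ, hsρ, hk2γ]
    have h2 : ‖w‖ ^ 2 ≤ (k ^ (-γ)) ^ 2 := by gcongr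
    have h3 : |ℓ - s| ≤ (3600 * M ^ 2 + 4) * (k ^ (-γ)) ^ 2 := by
      refine hℓ.trans ?_
      rw [hκdef]
      nlinarith
    have h4 := neg_le_of_abs_le hs1
    -- `ρ + σ|A|² = ρ (1 + s)` is at least `ρ / 2`, also for negative `σ`.
    calc ρ * |ℓ - s| ≤ ρ * ((3600 * M ^ 2 + 4) * (k ^ (-γ)) ^ 2) := by gcongr
      _ ≤ 2 * (1 + s) * (ρ * ((3600 * M ^ 2 + 4) * (k ^ (-γ)) ^ 2)) :=
        le_mul_of_one_le_left (by positivity) (by linarith)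
      _ = _ := by ring

end
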